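/- Let $\Gamma$ and $\Delta$ be finitely generated, torsion-free nilpotent groups. *Homogeneous dimension.* For a finite symmetric generating set $S$ of $\Gamma$ let $\gamma_S(n)$ be the number of elements of $\Gamma$ that are products of at most $n$ elements of $S$. The homogeneous dimension $d(\Gamma)$ is the natural number $d$ with $\gamma_S(n)\approx n^{d}$; here $f\approx g$ means that there is a constant $C>0$ with $f(n)\le C\,g(Cn)$ and $g(n)\le C\,f(Cn)$ for all $n\ge 1$. *Carnot completion.* Let $\widehat\Gamma$ be the Mal'tsev completion of $\Gamma$, i.e. the connected, simply connected nilpotent Lie group, unique up to isomorphism, in which $\Gamma$ embeds as a cocompact lattice. Let $\mathfrak g$ be its Lie algebra, with lower central series $\mathfrak g_1=\mathfrak g$, $\mathfrak g_{i+1}=[\mathfrak g,\mathfrak g_i]$. The bracket of $\mathfrak g$ induces a Lie bracket on $\mathfrak g_\infty=\bigoplus_{i\ge1}\mathfrak g_i/\mathfrak g_{i+1}$, and the Carnot completion $\Gamma_\infty$ is the connected, simply connected nilpotent Lie group with Lie algebra $\mathfrak g_\infty$. Define $\Delta_\infty$ in the same way from the Lie algebra $\mathfrak h$ of $\widehat\Delta$.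 *Metric.* Equip $\Delta_\infty$ with any Carnot–Carathéodory metric: fix a norm on the first layer $\mathfrak h_1/\mathfrak h_2$ of $\mathfrak h_\infty$, and let the distance of two points be the infimum of the lengths of the absolutely continuous curves that join them and are almost everywhere tangent to the left-invariant distribution spanned by $\mathfrak h_1/\mathfrak h_2$. Let $B(1,1_{\Delta_\infty})$ be the unit ball about the identity. Suppose that $d(\Gamma)=d(\Delta)$, and let $F:\Gamma_\infty\to\Delta_\infty$ be a continuous homomorphism. Then either $F$ is an isomorphism (of topological groups, equivalently of Lie groups), or there exists a continuous homomorphism $\ell:\Delta_\infty\to\mathbb R$ such that $\ell\circ F=0$ and $$\sup\{\ell(h): h\in B(1,1_{\Delta_\infty})\}=1 .$$ -/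

import Mathlib

/-! ### The graded Lie algebra associated with the lower central series -/

/-- The `(i+1)`-st term of the lower central series of `𝔤` (so `lcsTerm 𝔤 0 = 𝔤`, and
`lcsTerm 𝔤 (i + 1) = [𝔤, lcsTerm 𝔤 i]`), as a real subspace. -/
def lcsTerm (𝔤 : Type*) [LieRing 𝔤] [LieAlgebra ℝ 𝔤] (i : ℕ) : Submodule ℝ 𝔤 :=
  (LieModule.lowerCentralSeries ℝ 𝔤 𝔤 i).toSubmodule

theorem lcsTerm_lie {𝔤 : Type*} [LieRing 𝔤] [LieAlgebra ℝ 𝔤] (i j : ℕ) {x y : 𝔤}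
    (hx : x ∈ lcsTerm 𝔤 i) (hy : y ∈ lcsTerm 𝔤 j) : ⁅x, y⁆ ∈ lcsTerm 𝔤 (i + j + 1) := by
  have key : ∀ (a z : 𝔤) (k : ℕ), z ∈ lcsTerm 𝔤 k → ⁅a, z⁆ ∈ lcsTerm 𝔤 (k + 1) := by
    intro a z k hz
    simp only [lcsTerm, LieModule.lowerCentralSeries_succ, LieSubmodule.mem_toSubmodule] at hz ⊢
    exact LieSubmodule.lie_mem_lie (LieSubmodule.mem_top a) hz
  induction i generalizing j x y with
  | zero => simpa using key x y j hy
  | succ i ih =>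
    have hx' : x ∈ Submodule.span ℝ
        {m | ∃ a ∈ (⊤ : LieIdeal ℝ 𝔤), ∃ b ∈ LieModule.lowerCentralSeries ℝ 𝔤 𝔤 i, ⁅a, b⁆ = m} := by
      rw [← LieSubmodule.lieIdeal_oper_eq_linear_span']
      simpa [lcsTerm, LieModule.lowerCentralSeries_succ] using hx
    induction hx' using Submodule.span_induction with
    | mem m hm =>
      obtain ⟨a, -, b, hb, rfl⟩ := hm
      rw [lie_lie]
      have h1 := key a _ _ (ih j (x := b) hb hy)
      have h2 := ih (j + 1) (x := b) hb (key a y j hy)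
      rw [show i + 1 + j + 1 = i + j + 1 + 1 by ring]
      exact Submodule.sub_mem _ h1 (by simpa [add_assoc] using h2)
    | zero => simp
    | add u v _ _ hu hv =>
      rw [add_lie]
      refine Submodule.add_mem _ (hu ?_) (hv ?_)
      all_goals
        simp only [lcsTerm, LieModule.lowerCentralSeries_succ, LieSubmodule.mem_toSubmodule]
        rw [← LieSubmodule.mem_toSubmodule, LieSubmodule.lieIdeal_oper_eq_linear_span']
        assumption
    | smul t u _ hu =>
      rw [smul_lie]
      refine Submodule.smul_mem _ _ (hu ?_)
      simp only [lcsTerm, LieModule.lowerCentralSeries_succ, LieSubmodule.mem_toSubmodule]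
      rw [← LieSubmodule.mem_toSubmodule, LieSubmodule.lieIdeal_oper_eq_linear_span']
      assumption

/-- The layer `𝔤_{i+1} / 𝔤_{i+2}` of the associated graded Lie algebra. -/
abbrev GrLayer (𝔤 : Type*) [LieRing 𝔤] [LieAlgebra ℝ 𝔤] (i : ℕ) : Type _ :=
  (lcsTerm 𝔤 i) ⧸ ((lcsTerm 𝔤 (i + 1)).comap (lcsTerm 𝔤 i).subtype)

/-- The class in `𝔤_{i+1} / 𝔤_{i+2}` of an element of `𝔤_{i+1}`. -/
def grMk {𝔤 : Type*} [LieRing 𝔤] [LieAlgebra ℝ 𝔤] (i : ℕ) : lcsTerm 𝔤 i →ₗ[ℝ] GrLayer 𝔤 i :=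
  Submodule.mkQ _

theorem grMk_eq_zero {𝔤 : Type*} [LieRing 𝔤] [LieAlgebra ℝ 𝔤] (i : ℕ) (x : lcsTerm 𝔤 i)
    (hx : (x : 𝔤) ∈ lcsTerm 𝔤 (i + 1)) : grMk i x = 0 := by
  simpa [grMk] using hx

theorem grMk_surjective {𝔤 : Type*} [LieRing 𝔤] [LieAlgebra ℝ 𝔤] (i : ℕ) :
    Function.Surjective (grMk (𝔤 := 𝔤) i) :=
  Submodule.mkQ_surjective _

/-- The bracket `𝔤_{i+1} × 𝔤_{j+1} → 𝔤_{i+j+2} / 𝔤_{i+j+3}`. -/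
def grBracketAux (𝔤 : Type*) [LieRing 𝔤] [LieAlgebra ℝ 𝔤] (i j : ℕ) :
    lcsTerm 𝔤 i →ₗ[ℝ] lcsTerm 𝔤 j →ₗ[ℝ] GrLayer 𝔤 (i + j + 1) :=
  LinearMap.mk₂ ℝ (fun x y => grMk (i + j + 1) ⟨⁅(x : 𝔤), (y : 𝔤)⁆, lcsTerm_lie i j x.2 y.2⟩)
    (fun x x' y => by rw [← map_add]; congr 1; ext; simp)
    (fun t x y => by rw [← map_smul]; congr 1; ext; simp)
    (fun x y y' => by rw [← map_add]; congr 1; ext; simp)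
    (fun t x y => by rw [← map_smul]; congr 1; ext; simp)

/-- The bracket `𝔤_{i+1}/𝔤_{i+2} × 𝔤_{j+1}/𝔤_{j+2} → 𝔤_{i+j+2}/𝔤_{i+j+3}` induced by that of `𝔤`. -/
def grBracketLayer (𝔤 : Type*) [LieRing 𝔤] [LieAlgebra ℝ 𝔤] (i j : ℕ) :
    GrLayer 𝔤 i →ₗ[ℝ] GrLayer 𝔤 j →ₗ[ℝ] GrLayer 𝔤 (i + j + 1) :=
  Submodule.liftQ _
    (LinearMap.flip (Submodule.liftQ _ (LinearMap.flip (grBracketAux 𝔤 i j)) (by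
      intro y hy
      rw [LinearMap.mem_ker]
      ext x
      refine grMk_eq_zero _ _ ?_
      simpa [add_assoc] using lcsTerm_lie i (j + 1) x.2 (Submodule.mem_comap.1 hy))))
    (by
      intro x hx
      rw [LinearMap.mem_ker]
      ext y
      refine grMk_eq_zero _ _ ?_
      have h := lcsTerm_lie (i + 1) j (Submodule.mem_comap.1 hx) y.2
      rw [show i + 1 + j + 1 = i + j + 1 + 1 by ring] at h
      exact h)

theorem grBracketLayer_mk {𝔤 : Type*} [LieRing 𝔤] [LieAlgebra ℝ 𝔤] (i j : ℕ)
    (x : lcsTerm 𝔤 i) (y : lcsTerm 𝔤 j) :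
    grBracketLayer 𝔤 i j (grMk i x) (grMk j y) =
      grMk (i + j + 1) ⟨⁅(x : 𝔤), (y : 𝔤)⁆, lcsTerm_lie i j x.2 y.2⟩ := rfl

/-- The graded vector space `𝔤_∞ = ⨁ 𝔤_i / 𝔤_{i+1}` over the layers of the lower central series
(the layers beyond the step length vanish). -/
def GradedLie (𝔤 : Type*) [LieRing 𝔤] [LieAlgebra ℝ 𝔤] : Type _ :=
  DirectSum ℕ (fun i => GrLayer 𝔤 i)

noncomputable instance (𝔤 : Type*) [LieRing 𝔤] [LieAlgebra ℝ 𝔤] : AddCommGroup (GradedLie 𝔤) :=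
  inferInstanceAs (AddCommGroup (DirectSum ℕ (fun i => GrLayer 𝔤 i)))

noncomputable instance (𝔤 : Type*) [LieRing 𝔤] [LieAlgebra ℝ 𝔤] : Module ℝ (GradedLie 𝔤) :=
  inferInstanceAs (Module ℝ (DirectSum ℕ (fun i => GrLayer 𝔤 i)))

/-- The inclusion of the layer `𝔤_{i+1} / 𝔤_{i+2}` into `𝔤_∞`. -/
noncomputable def GradedLie.incl (𝔤 : Type*) [LieRing 𝔤] [LieAlgebra ℝ 𝔤] (i : ℕ) :
    GrLayer 𝔤 i →ₗ[ℝ] GradedLie 𝔤 :=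
  DirectSum.lof ℝ ℕ (fun i => GrLayer 𝔤 i) i

/-- The bilinear extension to `𝔤_∞` of the brackets between the layers. -/
noncomputable def GradedLie.bracket (𝔤 : Type*) [LieRing 𝔤] [LieAlgebra ℝ 𝔤] :
    GradedLie 𝔤 →ₗ[ℝ] GradedLie 𝔤 →ₗ[ℝ] GradedLie 𝔤 :=
  DirectSum.toModule ℝ ℕ (GradedLie 𝔤 →ₗ[ℝ] GradedLie 𝔤) fun i =>
    LinearMap.flip (DirectSum.toModule ℝ ℕ (GrLayer 𝔤 i →ₗ[ℝ] GradedLie 𝔤) fun j =>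
      LinearMap.flip ((grBracketLayer 𝔤 i j).compr₂ (GradedLie.incl 𝔤 (i + j + 1))))

theorem GradedLie.bracket_incl {𝔤 : Type*} [LieRing 𝔤] [LieAlgebra ℝ 𝔤] (i j : ℕ)
    (x : lcsTerm 𝔤 i) (y : lcsTerm 𝔤 j) :
    GradedLie.bracket 𝔤 (GradedLie.incl 𝔤 i (grMk i x)) (GradedLie.incl 𝔤 j (grMk j y)) =
      GradedLie.incl 𝔤 (i + j + 1)
        (grMk (i + j + 1) ⟨⁅(x : 𝔤), (y : 𝔤)⁆, lcsTerm_lie i j x.2 y.2⟩) := by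
  rw [← grBracketLayer_mk]
  have h1 := DirectSum.toModule_lof (M := fun i => GrLayer 𝔤 i) ℝ i
    (φ := fun i => LinearMap.flip
      (DirectSum.toModule ℝ ℕ (GrLayer 𝔤 i →ₗ[ℝ] GradedLie 𝔤) fun j =>
        LinearMap.flip ((grBracketLayer 𝔤 i j).compr₂ (GradedLie.incl 𝔤 (i + j + 1)))))
    (grMk i x)
  have h2 := DirectSum.toModule_lof (M := fun i => GrLayer 𝔤 i) ℝ j
    (φ := fun j =>
      LinearMap.flip ((grBracketLayer 𝔤 i j).compr₂ (GradedLie.incl 𝔤 (i + j + 1))))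
    (grMk j y)
  exact (LinearMap.congr_fun h1 _).trans (LinearMap.congr_fun h2 _)

theorem GradedLie.incl_congr {𝔤 : Type*} [LieRing 𝔤] [LieAlgebra ℝ 𝔤] {i j : ℕ} (h : i = j)
    (x : 𝔤) (hx : x ∈ lcsTerm 𝔤 i) (hx' : x ∈ lcsTerm 𝔤 j) :
    GradedLie.incl 𝔤 i (grMk i ⟨x, hx⟩) = GradedLie.incl 𝔤 j (grMk j ⟨x, hx'⟩) := by
  subst h; rfl

theorem GradedLie.induction {𝔤 : Type*} [LieRing 𝔤] [LieAlgebra ℝ 𝔤] {p : GradedLie 𝔤 → Prop}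
    (h0 : p 0) (h1 : ∀ i (x : lcsTerm 𝔤 i), p (GradedLie.incl 𝔤 i (grMk i x)))
    (h2 : ∀ x y, p x → p y → p (x + y)) (x : GradedLie 𝔤) : p x := by
  refine DirectSum.induction_on (motive := p) x h0 (fun i y => ?_) h2
  obtain ⟨z, rfl⟩ := grMk_surjective i y
  exact h1 i z

theorem GradedLie.bracket_anti {𝔤 : Type*} [LieRing 𝔤] [LieAlgebra ℝ 𝔤] (x y : GradedLie 𝔤) :
    GradedLie.bracket 𝔤 x y = - GradedLie.bracket 𝔤 y x := by
  induction x using GradedLie.induction with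
  | h0 => simp
  | h2 u v hu hv => rw [map_add, LinearMap.add_apply, hu, hv, map_add, neg_add]
  | h1 i x =>
    induction y using GradedLie.induction with
    | h0 => simp
    | h2 u v hu hv => rw [map_add, hu, hv, map_add, LinearMap.add_apply, neg_add]
    | h1 j y =>
      have h := lcsTerm_lie j i y.2 x.2
      rw [show j + i + 1 = i + j + 1 by ring] at h
      rw [GradedLie.bracket_incl, GradedLie.bracket_incl,
        GradedLie.incl_congr (show j + i + 1 = i + j + 1 by ring) ⁅(y : 𝔤), (x : 𝔤)⁆ _ h,
        ← map_neg, ← map_neg]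
      congr 2
      ext
      simp

theorem GradedLie.bracket_jacobi {𝔤 : Type*} [LieRing 𝔤] [LieAlgebra ℝ 𝔤] (x y z : GradedLie 𝔤) :
    GradedLie.bracket 𝔤 x (GradedLie.bracket 𝔤 y z) =
      GradedLie.bracket 𝔤 (GradedLie.bracket 𝔤 x y) z +
        GradedLie.bracket 𝔤 y (GradedLie.bracket 𝔤 x z) := by
  induction x using GradedLie.induction with
  | h0 => simp
  | h2 u v hu hv => simp only [map_add, LinearMap.add_apply, hu, hv]; abel
  | h1 i x =>
    induction y using GradedLie.induction with
    | h0 => simp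
    | h2 u v hu hv => simp only [map_add, LinearMap.add_apply, hu, hv]; abel
    | h1 j y =>
      induction z using GradedLie.induction with
      | h0 => simp
      | h2 u v hu hv => simp only [map_add, hu, hv]; abel
      | h1 k z =>
        have hxyz := lcsTerm_lie (i + j + 1) k (lcsTerm_lie i j x.2 y.2) z.2
        rw [show i + j + 1 + k + 1 = i + (j + k + 1) + 1 by ring] at hxyz
        have hyxz := lcsTerm_lie j (i + k + 1) y.2 (lcsTerm_lie i k x.2 z.2)
        rw [show j + (i + k + 1) + 1 = i + (j + k + 1) + 1 by ring] at hyxz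
        simp only [GradedLie.bracket_incl]
        rw [GradedLie.incl_congr (show i + j + 1 + k + 1 = i + (j + k + 1) + 1 by ring)
            ⁅⁅(x : 𝔤), (y : 𝔤)⁆, (z : 𝔤)⁆ _ hxyz,
          GradedLie.incl_congr (show j + (i + k + 1) + 1 = i + (j + k + 1) + 1 by ring)
            ⁅(y : 𝔤), ⁅(x : 𝔤), (z : 𝔤)⁆⁆ _ hyxz,
          ← map_add, ← map_add]
        congr 2
        ext
        simp

noncomputable instance (𝔤 : Type*) [LieRing 𝔤] [LieAlgebra ℝ 𝔤] : LieRing (GradedLie 𝔤) where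
  bracket x y := GradedLie.bracket 𝔤 x y
  add_lie x y z := by
    change GradedLie.bracket 𝔤 (x + y) z = GradedLie.bracket 𝔤 x z + GradedLie.bracket 𝔤 y z
    simp
  lie_add x y z := by
    change GradedLie.bracket 𝔤 x (y + z) = GradedLie.bracket 𝔤 x y + GradedLie.bracket 𝔤 x z
    simp
  lie_self x := by
    change GradedLie.bracket 𝔤 x x = 0
    have h := eq_neg_iff_add_eq_zero.mp (GradedLie.bracket_anti x x)
    rw [← two_smul ℝ] at h
    exact (smul_eq_zero.mp h).resolve_left two_ne_zero
  leibniz_lie x y z := GradedLie.bracket_jacobi x y z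

noncomputable instance (𝔤 : Type*) [LieRing 𝔤] [LieAlgebra ℝ 𝔤] : LieAlgebra ℝ (GradedLie 𝔤) where
  lie_smul t x y := by
    change GradedLie.bracket 𝔤 x (t • y) = t • GradedLie.bracket 𝔤 x y
    simp

/-! ### The simply connected nilpotent Lie group with a given Lie algebra -/

/-- The right-nested commutator `[x₁, [x₂, …, [xₘ₋₁, xₘ] … ]]` of a word in a Lie algebra. -/
def nestedLie {𝔤 : Type*} [LieRing 𝔤] : List 𝔤 → 𝔤
  | [] => 0
  | [x] => x
  | x :: y :: w => ⁅x, nestedLie (y :: w)⁆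

/-- The Baker–Campbell–Hausdorff series `log (exp x · exp y)` in a nilpotent Lie algebra, in
Dynkin's form
`∑ₙ (-1)ⁿ⁻¹/n ∑_{rᵢ+sᵢ>0} [x^{r₁} y^{s₁} ⋯ x^{rₙ} y^{sₙ}] / (∑ᵢ (rᵢ+sᵢ) ∏ᵢ rᵢ! sᵢ!)`.
Commutators of more than `c` letters vanish, `c` being the step length, so that it suffices to let
`n` and the exponents run up to `c`. -/
noncomputable def bch {𝔤 : Type*} [LieRing 𝔤] [LieAlgebra ℝ 𝔤] (x y : 𝔤) : 𝔤 :=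
  let c := LieModule.nilpotencyLength 𝔤 𝔤
  ∑ n ∈ Finset.Icc 1 c,
    ∑ p ∈ Fintype.piFinset (fun _ : Fin n => Finset.range (c + 1) ×ˢ Finset.range (c + 1)) with
        ∀ i, 0 < (p i).1 + (p i).2,
      ((-1 : ℝ) ^ (n - 1) / n *
          ((∑ i, ((p i).1 + (p i).2 : ℝ)) *
            ∏ i, (((p i).1.factorial : ℝ) * ((p i).2.factorial : ℝ)))⁻¹) •
        nestedLie (List.ofFn fun i =>
          List.replicate (p i).1 x ++ List.replicate (p i).2 y).flatten

/-- The connected, simply connected nilpotent Lie group `exp 𝔤` of a finite-dimensional nilpotent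
real Lie algebra `𝔤`, in exponential coordinates: its elements are the `exp x` with `x ∈ 𝔤`. -/
@[ext] structure ExpGroup (𝔤 : Type*) where
  /-- the exponential map -/
  exp ::
  /-- the logarithm -/
  log : 𝔤

/-- `exp x * exp y = exp (bch x y)`. -/
noncomputable instance (𝔤 : Type*) [LieRing 𝔤] [LieAlgebra ℝ 𝔤] : Mul (ExpGroup 𝔤) where
  mul g h := ExpGroup.exp (bch g.log h.log)

instance (𝔤 : Type*) [LieRing 𝔤] : One (ExpGroup 𝔤) where
  one := ExpGroup.exp 0

instance (𝔤 : Type*) [LieRing 𝔤] : Inv (ExpGroup 𝔤) where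
  inv g := ExpGroup.exp (-g.log)

/-- The topology for which `exp` is a homeomorphism, where the finite-dimensional real vector
space `𝔤` carries its usual topology. -/
instance (𝔤 : Type*) [LieRing 𝔤] [LieAlgebra ℝ 𝔤] : TopologicalSpace (ExpGroup 𝔤) :=
  TopologicalSpace.induced ExpGroup.log (moduleTopology ℝ 𝔤)

/-- `i` embeds `Γ` as a cocompact lattice into the simply connected nilpotent Lie group `exp 𝔤`,
that is, `exp 𝔤` together with `i` is the Mal'tsev completion of `Γ`. -/
structure IsMaltsevCompletion {Γ 𝔤 : Type*} [Group Γ] [LieRing 𝔤] [LieAlgebra ℝ 𝔤]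
    (i : Γ → ExpGroup 𝔤) : Prop where
  finiteDimensional : FiniteDimensional ℝ 𝔤
  nilpotent : LieRing.IsNilpotent 𝔤
  map_mul : ∀ a b, i (a * b) = i a * i b
  injective : Function.Injective i
  discrete : DiscreteTopology (Set.range i)
  cocompact : ∃ K : Set (ExpGroup 𝔤), IsCompact K ∧ ∀ g, ∃ a : Γ, ∃ k ∈ K, g = i a * k

/-- If `exp 𝔤` is the Mal'tsev completion of `Γ`, then the Carnot completion `Γ_∞` of `Γ` is the
simply connected nilpotent Lie group of the graded Lie algebra associated with `𝔤`. -/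
abbrev CarnotCompletion (𝔤 : Type*) [LieRing 𝔤] [LieAlgebra ℝ 𝔤] : Type _ :=
  ExpGroup (GradedLie 𝔤)

/-! ### Carnot–Carathéodory metrics -/

/-- The curve `γ` in the Carnot completion is absolutely continuous on `[0, 1]`, and for almost
every `t` it is differentiable at `t` with velocity the left translate by `γ t` of the vector `u t`
of the first layer `𝔤 / [𝔤, 𝔤]`, i.e. `log (γ(t)⁻¹ γ(t + s)) = s u(t) + o(s)` as `s → 0`.
(Curves in the finite-dimensional space `𝔤_∞` are treated through linear functionals.) -/
def IsHorizontalCurve {𝔤 : Type*} [LieRing 𝔤] [LieAlgebra ℝ 𝔤]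
    (γ : ℝ → CarnotCompletion 𝔤) (u : ℝ → GrLayer 𝔤 0) : Prop :=
  (∀ f : GradedLie 𝔤 →ₗ[ℝ] ℝ, AbsolutelyContinuousOnInterval (fun t => f (γ t).log) 0 1) ∧
  ∀ᵐ t ∂(MeasureTheory.volume.restrict (Set.Ioo (0 : ℝ) 1)), ∀ f : GradedLie 𝔤 →ₗ[ℝ] ℝ,
    HasDerivAt (fun s : ℝ => f ((γ t)⁻¹ * γ (t + s)).log) (f (GradedLie.incl 𝔤 0 (u t))) 0

/-- The Carnot–Carathéodory distance on the Carnot completion determined by a norm `N` on the first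
layer: the infimum of the `N`-lengths of the horizontal curves from `g` to `h`. -/
noncomputable def ccDist {𝔤 : Type*} [LieRing 𝔤] [LieAlgebra ℝ 𝔤]
    (N : Seminorm ℝ (GrLayer 𝔤 0)) (g h : CarnotCompletion 𝔤) : ENNReal :=
  ⨅ (γ : ℝ → CarnotCompletion 𝔤) (u : ℝ → GrLayer 𝔤 0) (_ : IsHorizontalCurve γ u)
    (_ : γ 0 = g) (_ : γ 1 = h), ∫⁻ t in Set.Ioo (0 : ℝ) 1, ENNReal.ofReal (N (u t))

/-! ### Growth -/

/-- The ball of radius `n` about `1` in the word metric of `S`. -/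
def wordBall {Γ : Type*} [Group Γ] (S : Set Γ) (n : ℕ) : Set Γ :=
  {g | ∃ w : List Γ, w.length ≤ n ∧ (∀ a ∈ w, a ∈ S) ∧ w.prod = g}

/-- `f ≼ g`: there is `C > 0` with `f n ≤ C g (C n)` for all `n ≥ 1`. -/
def GrowthLE (f g : ℕ → ℕ) : Prop :=
  ∃ C : ℕ, 0 < C ∧ ∀ n : ℕ, 1 ≤ n → f n ≤ C * g (C * n)

/-- The homogeneous dimension `d(Γ)`: the degree `d` such that the growth function of `Γ` with
respect to a finite symmetric generating set is equivalent to `n ↦ n ^ d`. (There is at most one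
such `d`, and it exists for every finitely generated nilpotent group.) -/
noncomputable def homogeneousDimension (Γ : Type*) [Group Γ] : ℕ :=
  sInf {d | ∃ S : Set Γ, S.Finite ∧ (∀ a ∈ S, a⁻¹ ∈ S) ∧ Subgroup.closure S = ⊤ ∧
    GrowthLE (fun n => (wordBall S n).ncard) (fun n => n ^ d) ∧
    GrowthLE (fun n => n ^ d) (fun n => (wordBall S n).ncard)}

/-! ### The lower central series and nested commutators -/

/-! A continuous homomorphism `F` is `exp ∘ f ∘ log` for a Lie algebra homomorphism `f`
(`exists_lieHom_of_continuous`). Although `f` need not respect the grading, it respects the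
filtration by degree, and so induces maps on the layers (`layerMap`). The dichotomy is whether the
map on the first layer is surjective.

If it is not, some nonzero linear form `ψ` on the first layer of the target kills its image. Since
the group law is additive modulo commutators, `ψ` composed with `log` and the projection to the
first layer is a homomorphism to ℝ that vanishes on the image of `F`. Its supremum over the
Carnot–Carathéodory unit ball is the dual norm of `ψ` (`isLUB_image_ccBall`), so a multiple of `ψ`
gives the required form.

If it is, then every layer map is surjective, because the graded algebra is generated by its first
layer (`layerMap_surjective`). Hence each layer of the target has at most the dimension of the
corresponding layer of the source. The homogeneous dimension is the sum of these dimensions with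
positive weights `k + 1`, so `d(Γ) = d(Δ)` forces equality in every layer, and `f` is bijective
(`bijective_of_layerMap`).

Most of the work is the formula for the homogeneous dimension (Bass–Guivarc'h,
`homogeneousDimension_eq_sum`). The word ball is counted along the tower of its images modulo the
terms of the lower central series; the fibre of one step is `layerImage`. Commutators of powers
produce about `n ^ ((k + 1) d)` points of a layer of dimension `d` inside a ball of radius `O(n)`
(`IsReachable.lie`). Conversely, the degree `k + 1` component of the logarithm of a word of length
`n` is `O(n ^ (k + 1))` (`exists_log_wordBall_le`), and the lattice is discrete in each layer
(`exists_ncard_layer_le`).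

Of the Baker–Campbell–Hausdorff series only the terms up to order two and the shape of the others
enter (`exists_bch_expansion`). Associativity of `bch` is never needed: wherever cancellation is
used, it takes place in `Γ` or follows from a filtration argument. -/

theorem lcsTerm_zero (𝔤 : Type*) [LieRing 𝔤] [LieAlgebra ℝ 𝔤] : lcsTerm 𝔤 0 = ⊤ := by
  simp [lcsTerm]

theorem mem_lcsTerm_zero {𝔤 : Type*} [LieRing 𝔤] [LieAlgebra ℝ 𝔤] (x : 𝔤) : x ∈ lcsTerm 𝔤 0 := by
  simp [lcsTerm_zero]

theorem lcsTerm_antitone (𝔤 : Type*) [LieRing 𝔤] [LieAlgebra ℝ 𝔤] : Antitone (lcsTerm 𝔤) :=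
  fun _ _ h => LieModule.antitone_lowerCentralSeries ℝ 𝔤 𝔤 h

theorem lcsTerm_nilpotencyLength (𝔤 : Type*) [LieRing 𝔤] [LieAlgebra ℝ 𝔤]
    [LieRing.IsNilpotent 𝔤] : lcsTerm 𝔤 (LieModule.nilpotencyLength 𝔤 𝔤) = ⊥ := by
  -- `nilpotencyLength` is defined by the lower central series over ℤ, whose terms are the same sets
  -- as those over ℝ.
  have h : LieModule.lowerCentralSeries ℤ 𝔤 𝔤 (LieModule.nilpotencyLength 𝔤 𝔤) = ⊥ := by
    obtain ⟨k, hk⟩ := LieModule.IsNilpotent.nilpotent ℤ 𝔤 𝔤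
    exact Nat.sInf_mem (s := {k | LieModule.lowerCentralSeries ℤ 𝔤 𝔤 k = ⊥}) ⟨k, hk⟩
  have h' : LieModule.lowerCentralSeries ℝ 𝔤 𝔤 (LieModule.nilpotencyLength 𝔤 𝔤) = ⊥ := by
    rw [SetLike.ext'_iff, LieModule.coe_lowerCentralSeries_eq_int ℝ 𝔤 𝔤, h]
    rfl
  simp [lcsTerm, h']

theorem lcsTerm_eq_bot {𝔤 : Type*} [LieRing 𝔤] [LieAlgebra ℝ 𝔤] [LieRing.IsNilpotent 𝔤] {i : ℕ}
    (hi : LieModule.nilpotencyLength 𝔤 𝔤 ≤ i) : lcsTerm 𝔤 i = ⊥ :=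
  le_bot_iff.mp ((lcsTerm_antitone 𝔤 hi).trans (lcsTerm_nilpotencyLength 𝔤).le)

theorem lie_mem_lcsTerm_succ_left {𝔤 : Type*} [LieRing 𝔤] [LieAlgebra ℝ 𝔤] {i : ℕ} {x : 𝔤}
    (hx : x ∈ lcsTerm 𝔤 i) (y : 𝔤) : ⁅x, y⁆ ∈ lcsTerm 𝔤 (i + 1) :=
  lcsTerm_lie i 0 hx (mem_lcsTerm_zero y)

theorem lie_mem_lcsTerm_succ_right {𝔤 : Type*} [LieRing 𝔤] [LieAlgebra ℝ 𝔤] {i : ℕ} (x : 𝔤)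
    {y : 𝔤} (hy : y ∈ lcsTerm 𝔤 i) : ⁅x, y⁆ ∈ lcsTerm 𝔤 (i + 1) := by
  simpa using lcsTerm_lie 0 i (mem_lcsTerm_zero x) hy

/-- The nested commutator of a word in two letters, evaluated at `x` (for `true`) and `y`. -/
def lieWord {𝔤 : Type*} [LieRing 𝔤] (w : List Bool) (x y : 𝔤) : 𝔤 :=
  nestedLie (w.map fun b => cond b x y)

theorem lieWord_cons_cons {𝔤 : Type*} [LieRing 𝔤] (a b : Bool) (w : List Bool) (x y : 𝔤) :
    lieWord (a :: b :: w) x y = ⁅cond a x y, lieWord (b :: w) x y⁆ := rfl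

theorem lieWord_singleton {𝔤 : Type*} [LieRing 𝔤] (a : Bool) (x y : 𝔤) :
    lieWord [a] x y = cond a x y := rfl

theorem lieWord_nil {𝔤 : Type*} [LieRing 𝔤] (x y : 𝔤) : lieWord [] x y = 0 := rfl

/-- Induction over the nonempty words, one letter at a time. -/
theorem List.cons_cons_induction {α : Type*} {p : List α → Prop} (nil : p [])
    (single : ∀ a, p [a]) (cons : ∀ a b w, p (b :: w) → p (a :: b :: w)) (w : List α) : p w := by
  induction w with
  | nil => exact nil
  | cons a w ih =>
    cases w with
    | nil => exact single a
    | cons b w => exact cons a b w ih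

theorem lieWord_mem_lcsTerm {𝔤 : Type*} [LieRing 𝔤] [LieAlgebra ℝ 𝔤] (w : List Bool) (x y : 𝔤) :
    lieWord w x y ∈ lcsTerm 𝔤 (w.length - 1) := by
  induction w using List.cons_cons_induction with
  | nil => simp [lieWord_nil]
  | single a => exact mem_lcsTerm_zero _
  | cons a b w ih => exact lie_mem_lcsTerm_succ_right _ ih

/-- Only one letter is left, so the innermost bracket is that of an element with itself. -/
theorem lieWord_eq_zero_of_notMem {𝔤 : Type*} [LieRing 𝔤] (a : Bool) (w : List Bool) (x y : 𝔤)
    (ha : a ∉ w) (hw : 2 ≤ w.length) : lieWord w x y = 0 := by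
  have hw' : w = List.replicate w.length (!a) := by
    rw [List.eq_replicate_iff]
    refine ⟨rfl, fun b hb => ?_⟩
    have : b ≠ a := fun h => ha (h ▸ hb)
    revert this; cases a <;> cases b <;> simp
  have key : ∀ (b : Bool) (n : ℕ), lieWord (List.replicate (n + 2) b) x y = 0 := by
    intro b n
    induction n with
    | zero => exact lie_self _
    | succ n ih =>
      rw [List.replicate_succ, List.replicate_succ, lieWord_cons_cons, ← List.replicate_succ, ih,
        lie_zero]
  obtain ⟨n, hn⟩ := Nat.exists_eq_add_of_le' hw
  rw [hw', hn]
  exact key _ n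

/-! ### The shape of the Baker–Campbell–Hausdorff series -/

/-- The word `x^{r₁} y^{s₁} ⋯ x^{rₙ} y^{sₙ}`. -/
def dynkinWord (n : ℕ) (p : Fin n → ℕ × ℕ) : List Bool :=
  (List.ofFn fun i => List.replicate (p i).1 true ++ List.replicate (p i).2 false).flatten

/-- The coefficient of `[x^{r₁} y^{s₁} ⋯ x^{rₙ} y^{sₙ}]` in Dynkin's formula. -/
noncomputable def dynkinCoeff (n : ℕ) (p : Fin n → ℕ × ℕ) : ℝ :=
  (-1 : ℝ) ^ (n - 1) / n * ((∑ i, ((p i).1 + (p i).2 : ℝ)) *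
    ∏ i, (((p i).1.factorial : ℝ) * ((p i).2.factorial : ℝ)))⁻¹

/-- The index set of Dynkin's formula with `n` factors and exponents at most `c`. -/
def dynkinIndex (c n : ℕ) : Finset (Fin n → ℕ × ℕ) :=
  (Fintype.piFinset fun _ : Fin n => Finset.range (c + 1) ×ˢ Finset.range (c + 1)).filter
    fun p => ∀ i, 0 < (p i).1 + (p i).2

theorem bch_eq_sum_dynkin {𝔤 : Type*} [LieRing 𝔤] [LieAlgebra ℝ 𝔤] (x y : 𝔤) :
    bch x y = ∑ n ∈ Finset.Icc 1 (LieModule.nilpotencyLength 𝔤 𝔤),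
      ∑ p ∈ dynkinIndex (LieModule.nilpotencyLength 𝔤 𝔤) n,
        dynkinCoeff n p • lieWord (dynkinWord n p) x y := by
  simp only [bch, dynkinIndex, dynkinCoeff, lieWord, dynkinWord]
  refine Finset.sum_congr rfl fun n _ => Finset.sum_congr rfl fun p _ => ?_
  congr 2
  rw [List.map_flatten, List.map_ofFn]
  congr 2
  funext i
  simp

theorem length_dynkinWord (n : ℕ) (p : Fin n → ℕ × ℕ) :
    (dynkinWord n p).length = ∑ i, ((p i).1 + (p i).2) := by
  simp [dynkinWord, List.length_flatten, List.map_ofFn, List.sum_ofFn]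

theorem le_length_dynkinWord {c n : ℕ} {p : Fin n → ℕ × ℕ} (hp : p ∈ dynkinIndex c n) :
    n ≤ (dynkinWord n p).length := by
  rw [length_dynkinWord]
  calc n = ∑ _i : Fin n, 1 := by simp
    _ ≤ _ := Finset.sum_le_sum fun i _ => (Finset.mem_filter.mp hp).2 i

/-- In a word of at most two letters no exponent exceeds 2, so the truncation bound is irrelevant.
This reduces the low-order terms to a fixed finite list that `decide` can enumerate. -/
theorem dynkinIndex_filter_length {c n : ℕ} (hc : 2 ≤ c) :
    (dynkinIndex c n).filter (fun p => ¬ 3 ≤ (dynkinWord n p).length) =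
      (dynkinIndex 2 n).filter (fun p => ¬ 3 ≤ (dynkinWord n p).length) := by
  ext p
  simp only [dynkinIndex, Finset.mem_filter, Fintype.mem_piFinset, Finset.mem_product,
    Finset.mem_range, length_dynkinWord]
  constructor
  · rintro ⟨⟨_, h2⟩, h3⟩
    refine ⟨⟨fun i => ?_, h2⟩, h3⟩
    have := Finset.single_le_sum (f := fun i => (p i).1 + (p i).2) (fun _ _ => Nat.zero_le _)
      (Finset.mem_univ i)
    omega
  · rintro ⟨⟨h1, h2⟩, h3⟩
    exact ⟨⟨fun i => ⟨by linarith [(h1 i).1], by linarith [(h1 i).2]⟩, h2⟩, h3⟩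

theorem dynkinIndex_two_one :
    (dynkinIndex 2 1).filter (fun p => ¬ 3 ≤ (dynkinWord 1 p).length) =
      {![(1, 0)], ![(0, 1)], ![(1, 1)], ![(2, 0)], ![(0, 2)]} := by
  decide

theorem dynkinIndex_two_two :
    (dynkinIndex 2 2).filter (fun p => ¬ 3 ≤ (dynkinWord 2 p).length) =
      {![(1, 0), (1, 0)], ![(1, 0), (0, 1)], ![(0, 1), (1, 0)], ![(0, 1), (0, 1)]} := by
  decide

theorem dynkinIndex_one_one : dynkinIndex 1 1 = {![(1, 0)], ![(0, 1)], ![(1, 1)]} := by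
  decide

/-- The Baker–Campbell–Hausdorff series is `x + y + ½[x, y]` plus a combination of longer nested
commutators, each of which contains both letters. -/
theorem exists_bch_expansion (𝔤 : Type*) [LieRing 𝔤] [LieAlgebra ℝ 𝔤] [LieRing.IsNilpotent 𝔤] :
    ∃ (T : Finset (Σ n, Fin n → ℕ × ℕ)) (a : (Σ n, Fin n → ℕ × ℕ) → ℝ)
      (w : (Σ n, Fin n → ℕ × ℕ) → List Bool),
      (∀ k ∈ T, 3 ≤ (w k).length ∧ ∀ b, b ∈ w k) ∧
      ∀ x y : 𝔤, bch x y = x + y + (1 / 2 : ℝ) • ⁅x, y⁆ + ∑ k ∈ T, a k • lieWord (w k) x y := by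
  classical
  -- In length at most one the sum is cut off before the words of two letters are complete, but then
  -- the bracket is zero.
  obtain hc | hc := le_or_gt (LieModule.nilpotencyLength 𝔤 𝔤) 1
  · have htriv : LieModule.IsTrivial 𝔤 𝔤 := LieModule.isTrivial_of_nilpotencyLength_le_one 𝔤 𝔤 hc
    refine ⟨∅, 0, fun _ => [], by simp, fun x y => ?_⟩
    obtain hc | hc := Nat.le_one_iff_eq_zero_or_eq_one.mp hc
    · rw [LieModule.nilpotencyLength_eq_zero_iff] at hc
      exact Subsingleton.elim _ _
    · rw [bch_eq_sum_dynkin, hc]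
      simp only [Finset.Icc_self, Finset.sum_singleton, dynkinIndex_one_one]
      rw [Finset.sum_insert (by decide), Finset.sum_insert (by decide), Finset.sum_singleton]
      simp [dynkinCoeff, dynkinWord, lieWord, nestedLie, htriv.trivial]
  · refine ⟨((Finset.Icc 1 (LieModule.nilpotencyLength 𝔤 𝔤)).sigma
        (dynkinIndex (LieModule.nilpotencyLength 𝔤 𝔤))).filter
          (fun k => 3 ≤ (dynkinWord k.1 k.2).length ∧ ∀ b, b ∈ dynkinWord k.1 k.2),
      fun k => dynkinCoeff k.1 k.2, fun k => dynkinWord k.1 k.2,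
      fun k hk => (Finset.mem_filter.mp hk).2, fun x y => ?_⟩
    have hlow : ∑ k ∈ ((Finset.Icc 1 (LieModule.nilpotencyLength 𝔤 𝔤)).sigma
        (dynkinIndex (LieModule.nilpotencyLength 𝔤 𝔤))).filter
          (fun k => ¬ 3 ≤ (dynkinWord k.1 k.2).length),
          dynkinCoeff k.1 k.2 • lieWord (dynkinWord k.1 k.2) x y =
        x + y + (1 / 2 : ℝ) • ⁅x, y⁆ := by
      have hset : ((Finset.Icc 1 (LieModule.nilpotencyLength 𝔤 𝔤)).sigma
          (dynkinIndex (LieModule.nilpotencyLength 𝔤 𝔤))).filter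
            (fun k => ¬ 3 ≤ (dynkinWord k.1 k.2).length) =
          (Finset.Icc 1 2).sigma fun n =>
            (dynkinIndex 2 n).filter (fun p => ¬ 3 ≤ (dynkinWord n p).length) := by
        ext ⟨n, p⟩
        simp only [Finset.mem_filter, Finset.mem_sigma, Finset.mem_Icc]
        rw [← Finset.mem_filter (p := fun p => ¬ 3 ≤ (dynkinWord n p).length),
          ← dynkinIndex_filter_length hc, Finset.mem_filter]
        constructor
        · rintro ⟨⟨h1, h2⟩, h3⟩
          exact ⟨⟨h1.1, by linarith [le_length_dynkinWord h2]⟩, h2, h3⟩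
        · rintro ⟨h1, h2, h3⟩
          exact ⟨⟨⟨h1.1, h1.2.trans hc⟩, h2⟩, h3⟩
      rw [hset, Finset.sum_sigma, show Finset.Icc 1 2 = {1, 2} from rfl,
        Finset.sum_insert (by decide), Finset.sum_singleton]
      simp only
      rw [dynkinIndex_two_one, dynkinIndex_two_two]
      repeat rw [Finset.sum_insert (by decide)]
      rw [Finset.sum_singleton, Finset.sum_singleton]
      have hyx : ⁅y, x⁆ = -⁅x, y⁆ := (lie_skew y x).symm
      simp [dynkinCoeff, dynkinWord, lieWord, nestedLie, hyx, List.replicate_succ, -lie_skew]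
      module
    rw [bch_eq_sum_dynkin, Finset.sum_sigma', ← Finset.sum_filter_not_add_sum_filter _
      (fun k : (Σ n, Fin n → ℕ × ℕ) => 3 ≤ (dynkinWord k.1 k.2).length), hlow]
    congr 1
    symm
    -- Long words that omit a letter may be dropped: they vanish.
    rw [← Finset.filter_filter]
    refine Finset.sum_filter_of_ne fun k hk hne b => ?_
    by_contra hb
    refine hne ?_
    rw [lieWord_eq_zero_of_notMem b _ x y hb (by linarith [(Finset.mem_filter.mp hk).2]), smul_zero]

/-! ### The Baker–Campbell–Hausdorff series modulo the lower central series -/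

theorem lieWord_eq_zero_of_mem {𝔤 : Type*} [LieRing 𝔤] {a : Bool} {x y : 𝔤} (h : cond a x y = 0)
    (w : List Bool) (ha : a ∈ w) : lieWord w x y = 0 := by
  induction w using List.cons_cons_induction with
  | nil => rfl
  | single b => rw [lieWord_singleton, ← List.mem_singleton.mp ha, h]
  | cons b d w ih =>
    rw [lieWord_cons_cons]
    obtain rfl | ha := List.mem_cons.mp ha
    · rw [h, zero_lie]
    · rw [ih ha, lie_zero]

/-- Change one letter at a time: each difference has one entry in `lcsTerm 𝔤 k`, and each of the
remaining letters moves it one term deeper. -/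
theorem lieWord_sub_mem_lcsTerm {𝔤 : Type*} [LieRing 𝔤] [LieAlgebra ℝ 𝔤] {k : ℕ} {x x' y y' : 𝔤}
    (hx : x' - x ∈ lcsTerm 𝔤 k) (hy : y' - y ∈ lcsTerm 𝔤 k) (w : List Bool) :
    lieWord w x' y' - lieWord w x y ∈ lcsTerm 𝔤 (k + w.length - 1) := by
  have hcond : ∀ a : Bool, cond a x' y' - cond a x y ∈ lcsTerm 𝔤 k := by
    rintro (_ | _)
    exacts [hy, hx]
  induction w using List.cons_cons_induction with
  | nil => simp [lieWord_nil]
  | single a => simpa [lieWord_singleton] using hcond a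
  | cons a b w ih =>
    rw [lieWord_cons_cons, lieWord_cons_cons]
    have h : ⁅cond a x' y', lieWord (b :: w) x' y'⁆ - ⁅cond a x y, lieWord (b :: w) x y⁆ =
        ⁅cond a x' y' - cond a x y, lieWord (b :: w) x' y'⁆ +
          ⁅cond a x y, lieWord (b :: w) x' y' - lieWord (b :: w) x y⁆ := by
      rw [sub_lie, lie_sub]; abel
    rw [h]
    refine Submodule.add_mem _ ?_ ?_
    · exact lcsTerm_lie k w.length (hcond a) (lieWord_mem_lcsTerm (b :: w) x' y')
    · exact lie_mem_lcsTerm_succ_right _ ih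

theorem lieWord_mem_lcsTerm_of_mem {𝔤 : Type*} [LieRing 𝔤] [LieAlgebra ℝ 𝔤] {k : ℕ} {a : Bool}
    {x y : 𝔤} (h : cond a x y ∈ lcsTerm 𝔤 k) (w : List Bool) (ha : a ∈ w) :
    lieWord w x y ∈ lcsTerm 𝔤 (k + w.length - 1) := by
  cases a with
  | true =>
    have := lieWord_sub_mem_lcsTerm (x := 0) (x' := x) (y := y) (y' := y) (by simpa using h)
      (by simp) w
    rwa [lieWord_eq_zero_of_mem (a := true) rfl w ha, sub_zero] at this
  | false =>
    have := lieWord_sub_mem_lcsTerm (x := x) (x' := x) (y := 0) (y' := y) (k := k) (by simp)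
      (by simpa using h) w
    rwa [lieWord_eq_zero_of_mem (a := false) rfl w ha, sub_zero] at this

theorem lieWord_smul_smul {𝔤 : Type*} [LieRing 𝔤] [LieAlgebra ℝ 𝔤] (s t : ℝ) (x : 𝔤) (w : List Bool)
    (hw : 2 ≤ w.length) :
    lieWord w (s • x) (t • x) = 0 := by
  have h : ∀ w : List Bool, ∃ r : ℝ, lieWord w (s • x) (t • x) = r • x := by
    intro w
    induction w using List.cons_cons_induction with
    | nil => exact ⟨0, by simp [lieWord_nil]⟩
    | single a => cases a <;> exact ⟨_, rfl⟩
    | cons a b w ih =>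
      obtain ⟨r, hr⟩ := ih
      refine ⟨0, ?_⟩
      rw [lieWord_cons_cons, hr]
      cases a <;> simp
  match w, hw with
  | a :: b :: w, _ =>
    obtain ⟨r, hr⟩ := h (b :: w)
    rw [lieWord_cons_cons, hr]
    cases a <;> simp

section bch

variable {𝔤 : Type*} [LieRing 𝔤] [LieAlgebra ℝ 𝔤] [LieRing.IsNilpotent 𝔤]

/-- Every omitted word contains the letter `a` and at least two further letters, each worth one step
of depth. -/
theorem bch_sub_lie_mem {k : ℕ} (a : Bool) {x y : 𝔤} (h : cond a x y ∈ lcsTerm 𝔤 k) :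
    bch x y - (x + y + (1 / 2 : ℝ) • ⁅x, y⁆) ∈ lcsTerm 𝔤 (k + 2) := by
  obtain ⟨T, c, w, hw, hbch⟩ := exists_bch_expansion 𝔤
  rw [hbch, add_sub_cancel_left]
  refine Submodule.sum_mem _ fun t ht => Submodule.smul_mem _ _ ?_
  refine lcsTerm_antitone 𝔤 ?_ (lieWord_mem_lcsTerm_of_mem h (w t) ((hw t ht).2 a))
  have := (hw t ht).1
  omega

theorem bch_sub_add_mem {k : ℕ} (a : Bool) {x y : 𝔤} (h : cond a x y ∈ lcsTerm 𝔤 k) :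
    bch x y - (x + y) ∈ lcsTerm 𝔤 (k + 1) := by
  have h1 := lcsTerm_antitone 𝔤 (Nat.le_succ (k + 1)) (bch_sub_lie_mem a h)
  have h2 : ⁅x, y⁆ ∈ lcsTerm 𝔤 (k + 1) := by
    cases a with
    | true => exact lie_mem_lcsTerm_succ_left h y
    | false => exact lie_mem_lcsTerm_succ_right x h
  have := Submodule.add_mem _ h1 (Submodule.smul_mem _ (1 / 2 : ℝ) h2)
  convert this using 1
  abel

theorem bch_sub_add_mem_one (x y : 𝔤) : bch x y - (x + y) ∈ lcsTerm 𝔤 1 :=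
  bch_sub_add_mem (k := 0) true (mem_lcsTerm_zero _)

theorem bch_sub_add_mem_left {k : ℕ} {x : 𝔤} (h : x ∈ lcsTerm 𝔤 k) (y : 𝔤) :
    bch x y - (x + y) ∈ lcsTerm 𝔤 (k + 1) :=
  bch_sub_add_mem true h

theorem bch_sub_add_mem_right {k : ℕ} (x : 𝔤) {y : 𝔤} (h : y ∈ lcsTerm 𝔤 k) :
    bch x y - (x + y) ∈ lcsTerm 𝔤 (k + 1) :=
  bch_sub_add_mem false h

/-- Perturbations of the arguments add up to leading order, since every bracket pushes them one term
deeper. This replaces cancellation in the group `exp 𝔤`. -/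
theorem bch_sub_bch_mem {k : ℕ} {x x' y y' : 𝔤} (hx : x' - x ∈ lcsTerm 𝔤 k)
    (hy : y' - y ∈ lcsTerm 𝔤 k) :
    bch x' y' - bch x y - ((x' - x) + (y' - y)) ∈ lcsTerm 𝔤 (k + 1) := by
  obtain ⟨T, c, w, hw, hbch⟩ := exists_bch_expansion 𝔤
  rw [hbch, hbch]
  have h : x' + y' + (1 / 2 : ℝ) • ⁅x', y'⁆ + ∑ t ∈ T, c t • lieWord (w t) x' y' -
      (x + y + (1 / 2 : ℝ) • ⁅x, y⁆ + ∑ t ∈ T, c t • lieWord (w t) x y) -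
        ((x' - x) + (y' - y)) =
      (1 / 2 : ℝ) • (lieWord [true, false] x' y' - lieWord [true, false] x y) +
        ∑ t ∈ T, c t • (lieWord (w t) x' y' - lieWord (w t) x y) := by
    simp only [smul_sub, Finset.sum_sub_distrib]
    change _ = (1 / 2 : ℝ) • ⁅x', y'⁆ - (1 / 2 : ℝ) • ⁅x, y⁆ + _
    abel
  rw [h]
  refine Submodule.add_mem _ (Submodule.smul_mem _ _ ?_)
    (Submodule.sum_mem _ fun t ht => Submodule.smul_mem _ _ ?_)
  · exact lieWord_sub_mem_lcsTerm hx hy [true, false]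
  · refine lcsTerm_antitone 𝔤 ?_ (lieWord_sub_mem_lcsTerm hx hy (w t))
    have := (hw t ht).1
    omega

theorem eq_zero_of_forall_mem_lcsTerm {x : 𝔤} (h : ∀ k, x ∈ lcsTerm 𝔤 k) : x = 0 := by
  simpa [lcsTerm_nilpotencyLength] using h (LieModule.nilpotencyLength 𝔤 𝔤)

/-- An element is zero if it lies in every term of the lower central series after the terms
in which it lies. -/
theorem eq_zero_of_mem_lcsTerm_succ {x : 𝔤} (h : ∀ k, x ∈ lcsTerm 𝔤 k → x ∈ lcsTerm 𝔤 (k + 1)) :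
    x = 0 := by
  refine eq_zero_of_forall_mem_lcsTerm fun k => ?_
  induction k with
  | zero => exact mem_lcsTerm_zero x
  | succ k ih => exact h k ih

theorem bch_smul_smul (s t : ℝ) (x : 𝔤) : bch (s • x) (t • x) = (s + t) • x := by
  obtain ⟨T, c, w, hw, hbch⟩ := exists_bch_expansion 𝔤
  rw [hbch, Finset.sum_eq_zero fun k hk => by
    rw [lieWord_smul_smul s t x (w k) (by linarith [(hw k hk).1]), smul_zero]]
  simp [add_smul]

theorem bch_neg_self (x : 𝔤) : bch (-x) x = 0 := by
  simpa using bch_smul_smul (-1) 1 x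

theorem bch_self_neg (x : 𝔤) : bch x (-x) = 0 := by
  simpa using bch_smul_smul 1 (-1) x

theorem bch_self (x : 𝔤) : bch x x = (2 : ℝ) • x := by
  have := bch_smul_smul 1 1 x
  norm_num at this
  exact this

/-- Comparison with `bch x (-x) = 0` moves `y + x` ever deeper into the lower central series. -/
theorem eq_neg_of_bch_eq_zero {x y : 𝔤} (h : bch x y = 0) : y = -x := by
  rw [← sub_eq_zero]
  refine eq_zero_of_mem_lcsTerm_succ fun k hk => ?_
  have := bch_sub_bch_mem (x := x) (x' := x) (by simp) hk
  rw [h, bch_self_neg] at this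
  convert neg_mem this using 1
  abel

/-- Second order expansion of `bch (t • x) (t • y)` at `t = 0`. -/
theorem exists_bch_smul_expansion (𝔤 : Type*) [LieRing 𝔤] [LieAlgebra ℝ 𝔤] [LieRing.IsNilpotent 𝔤]
    [TopologicalSpace 𝔤] [IsModuleTopology ℝ 𝔤] :
    ∃ U : 𝔤 → 𝔤 → ℝ → 𝔤, ∀ x y, Continuous (U x y) ∧ U x y 0 = (1 / 2 : ℝ) • ⁅x, y⁆ ∧
      ∀ t : ℝ, bch (t • x) (t • y) = t • (x + y + t • U x y t) := by
  obtain ⟨T, c, w, hw, hbch⟩ := exists_bch_expansion 𝔤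
  have : ContinuousAdd 𝔤 := IsModuleTopology.toContinuousAdd ℝ 𝔤
  have hsmul : ∀ (t : ℝ) (x y : 𝔤) (w : List Bool),
      lieWord w (t • x) (t • y) = t ^ w.length • lieWord w x y := by
    intro t x y w
    have hcond : ∀ a : Bool, cond a (t • x) (t • y) = t • cond a x y := by
      rintro (_ | _) <;> rfl
    induction w using List.cons_cons_induction with
    | nil => simp [lieWord_nil]
    | single a => simp [lieWord_singleton, hcond]
    | cons a b w ih =>
      rw [lieWord_cons_cons, lieWord_cons_cons, ih, hcond, lie_smul, smul_lie, smul_smul,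
        List.length_cons (a := a), pow_succ]
  -- A word of length `m` scales by `t ^ m`, and `t ^ 2` is factored out. The words in `T` have `m ≥
  -- 3`, so they disappear at `t = 0`.
  refine ⟨fun x y t => (1 / 2 : ℝ) • ⁅x, y⁆ +
    ∑ k ∈ T, (c k * t ^ ((w k).length - 2)) • lieWord (w k) x y, fun x y => ⟨?_, ?_, fun t => ?_⟩⟩
  · fun_prop
  · simp only [add_eq_left]
    refine Finset.sum_eq_zero fun k hk => ?_
    rw [zero_pow (by have := (hw k hk).1; omega), mul_zero, zero_smul]
  · rw [hbch]
    simp only [smul_add, smul_lie, lie_smul, Finset.smul_sum, hsmul, smul_smul]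
    rw [← add_assoc]
    congr 1
    · congr 2
      ring
    refine Finset.sum_congr rfl fun k hk => ?_
    obtain ⟨n, hn⟩ := Nat.exists_eq_add_of_le' (hw k hk).1
    rw [hn, show n + 3 - 2 = n + 1 by omega]
    congr 1
    ring

theorem continuous_bch (𝔤 : Type*) [LieRing 𝔤] [LieAlgebra ℝ 𝔤] [LieRing.IsNilpotent 𝔤]
    [FiniteDimensional ℝ 𝔤] [TopologicalSpace 𝔤] [IsModuleTopology ℝ 𝔤] :
    Continuous fun p : 𝔤 × 𝔤 => bch p.1 p.2 := by
  obtain ⟨T, c, w, hw, hbch⟩ := exists_bch_expansion 𝔤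
  have : ContinuousAdd 𝔤 := IsModuleTopology.toContinuousAdd ℝ 𝔤
  have hlie : Continuous fun p : 𝔤 × 𝔤 => ⁅p.1, p.2⁆ :=
    IsModuleTopology.continuous_bilinear_of_finite_left (R := ℝ)
      (LieModule.toEnd ℝ 𝔤 𝔤 : 𝔤 →ₗ[ℝ] Module.End ℝ 𝔤)
  have hword : ∀ w : List Bool, Continuous fun p : 𝔤 × 𝔤 => lieWord w p.1 p.2 := by
    intro w
    have hcond : ∀ a : Bool, Continuous fun p : 𝔤 × 𝔤 => cond a p.1 p.2 := by
      rintro (_ | _)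
      exacts [continuous_snd, continuous_fst]
    induction w using List.cons_cons_induction with
    | nil => exact continuous_const
    | single a => exact hcond a
    | cons a b w ih => exact hlie.comp ((hcond a).prodMk ih)
  simp only [hbch]
  fun_prop

end bch

/-! ### Continuous homomorphisms between exponential groups -/

theorem t2Space_of_isModuleTopology (V : Type*) [AddCommGroup V] [Module ℝ V]
    [FiniteDimensional ℝ V] [TopologicalSpace V] [IsModuleTopology ℝ V] : T2Space V :=
  .of_injective_continuous (Module.finBasis ℝ V).equivFun.injective
    (IsModuleTopology.continuous_of_linearMap (R := ℝ)
      (Module.finBasis ℝ V).equivFun.toLinearMap)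

section homomorphism

variable {𝔤 𝔥 : Type*} [LieRing 𝔤] [LieAlgebra ℝ 𝔤] [LieRing.IsNilpotent 𝔤] [TopologicalSpace 𝔤]
  [LieRing 𝔥] [LieAlgebra ℝ 𝔥] [LieRing.IsNilpotent 𝔥] [TopologicalSpace 𝔥]
  [IsModuleTopology ℝ 𝔤] [IsModuleTopology ℝ 𝔥] [T2Space 𝔥]

/-- On the line `ℝ x` the operation `bch` is addition. Hence homogeneity holds for integers, then
for rationals, and by density and continuity for reals. -/
theorem map_smul_of_map_bch {φ : 𝔤 → 𝔥} (hφ : Continuous φ)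
    (hmul : ∀ x y, φ (bch x y) = bch (φ x) (φ y)) (t : ℝ) (x : 𝔤) : φ (t • x) = t • φ x := by
  have h0 : φ 0 = 0 := by
    have h := hmul 0 0
    rw [bch_self, bch_self, smul_zero, two_smul] at h
    exact left_eq_add.mp h
  have hneg : ∀ x, φ (-x) = -φ x := fun x =>
    eq_neg_of_bch_eq_zero (by rw [← hmul, bch_self_neg, h0])
  have hnat : ∀ (n : ℕ) (x : 𝔤), φ ((n : ℝ) • x) = (n : ℝ) • φ x := by
    intro n x
    induction n with
    | zero => simp [h0]
    | succ n ih =>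
      have h1 := bch_smul_smul (n : ℝ) 1 x
      have h2 := bch_smul_smul (n : ℝ) 1 (φ x)
      rw [one_smul] at h1 h2
      push_cast
      rw [← h1, hmul, ih, h2]
  have hint : ∀ (n : ℤ) (x : 𝔤), φ ((n : ℝ) • x) = (n : ℝ) • φ x := by
    intro n x
    obtain ⟨m, rfl | rfl⟩ := n.eq_nat_or_neg
    · exact_mod_cast hnat m x
    · push_cast
      rw [neg_smul, hneg, hnat, neg_smul]
  have hrat : ∀ (q : ℚ) (x : 𝔤), φ ((q : ℝ) • x) = (q : ℝ) • φ x := by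
    intro q x
    have hq : (q.den : ℝ) ≠ 0 := by exact_mod_cast q.den_nz
    have h1 : (q.den : ℝ) • φ ((q : ℝ) • x) = (q.num : ℝ) • φ x := by
      rw [← hnat, smul_smul, ← hint]
      congr 2
      exact_mod_cast Rat.den_mul_eq_num q
    rw [← inv_smul_smul₀ hq (φ ((q : ℝ) • x)), h1, smul_smul]
    congr 1
    rw [inv_mul_eq_div]
    exact_mod_cast Rat.num_div_den q
  have hc : Continuous fun t : ℝ => φ (t • x) := by fun_prop
  have hc' : Continuous fun t : ℝ => t • φ x := by fun_prop
  exact congrFun (hc.ext_on Rat.isDenseEmbedding_coe_real.dense hc'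
    (by rintro _ ⟨q, rfl⟩; exact hrat q x)) t

/-- Apply `φ` to `bch (t • x) (t • y)`. The limit `t → 0` after division by `t` gives additivity;
cancelling the linear part and dividing by `t` once more gives compatibility with the bracket. -/
theorem map_add_and_map_lie_of_map_bch {φ : 𝔤 → 𝔥} (hφ : Continuous φ)
    (hmul : ∀ x y, φ (bch x y) = bch (φ x) (φ y)) :
    (∀ x y, φ (x + y) = φ x + φ y) ∧ ∀ x y, φ ⁅x, y⁆ = ⁅φ x, φ y⁆ := by
  have : ContinuousAdd 𝔤 := IsModuleTopology.toContinuousAdd ℝ 𝔤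
  have : ContinuousAdd 𝔥 := IsModuleTopology.toContinuousAdd ℝ 𝔥
  have hsmul := map_smul_of_map_bch hφ hmul
  obtain ⟨U, hU⟩ := exists_bch_smul_expansion 𝔤
  obtain ⟨V, hV⟩ := exists_bch_smul_expansion 𝔥
  have hdense : Dense ({0}ᶜ : Set ℝ) := dense_compl_singleton 0
  have key : ∀ x y, ∀ t ∈ ({0}ᶜ : Set ℝ), φ (x + y + t • U x y t) =
      φ x + φ y + t • V (φ x) (φ y) t := by
    intro x y t ht
    have h := hmul (t • x) (t • y)
    rw [(hU x y).2.2, hsmul, hsmul, hsmul, (hV _ _).2.2] at h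
    exact smul_right_injective 𝔥 ht h
  have hadd : ∀ x y, φ (x + y) = φ x + φ y := by
    intro x y
    have hcU := (hU x y).1
    have hcV := (hV (φ x) (φ y)).1
    have h := congrFun (Continuous.ext_on hdense (f := fun t => φ (x + y + t • U x y t))
      (g := fun t => φ x + φ y + t • V (φ x) (φ y) t) (by fun_prop) (by fun_prop) (key x y)) 0
    simpa using h
  refine ⟨hadd, fun x y => ?_⟩
  have hcU := (hU x y).1
  have hcV := (hV (φ x) (φ y)).1
  have h := congrFun (Continuous.ext_on hdense (f := fun t => φ (U x y t))
    (g := fun t => V (φ x) (φ y) t) (by fun_prop) (by fun_prop) (fun t ht => by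
      have h := key x y t ht
      rw [hadd, hadd, hsmul, add_right_inj] at h
      exact smul_right_injective 𝔥 ht h)) 0
  simp only [(hU x y).2.1, (hV (φ x) (φ y)).2.1, hsmul] at h
  exact smul_right_injective 𝔥 (by norm_num : (1 / 2 : ℝ) ≠ 0) h

end homomorphism

/-- A continuous homomorphism between exponential groups is induced by a Lie algebra
homomorphism. -/
theorem exists_lieHom_of_continuous {𝔤 𝔥 : Type*} [LieRing 𝔤] [LieAlgebra ℝ 𝔤]
    [LieRing.IsNilpotent 𝔤] [LieRing 𝔥] [LieAlgebra ℝ 𝔥] [LieRing.IsNilpotent 𝔥]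
    [FiniteDimensional ℝ 𝔥] (F : ExpGroup 𝔤 →ₙ* ExpGroup 𝔥) (hF : Continuous F) :
    ∃ f : 𝔤 →ₗ⁅ℝ⁆ 𝔥, ∀ x, (F x).log = f x.log := by
  let _ : TopologicalSpace 𝔤 := moduleTopology ℝ 𝔤
  let _ : TopologicalSpace 𝔥 := moduleTopology ℝ 𝔥
  have : IsModuleTopology ℝ 𝔤 := ⟨rfl⟩
  have : IsModuleTopology ℝ 𝔥 := ⟨rfl⟩
  have : T2Space 𝔥 := t2Space_of_isModuleTopology 𝔥
  have hexp : Continuous (ExpGroup.exp : 𝔤 → ExpGroup 𝔤) := continuous_induced_rng.mpr continuous_id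
  have hlog : Continuous (ExpGroup.log : ExpGroup 𝔥 → 𝔥) := continuous_induced_dom
  let φ : 𝔤 → 𝔥 := fun x => (F (ExpGroup.exp x)).log
  have hφ : Continuous φ := hlog.comp (hF.comp hexp)
  have hmul : ∀ x y, φ (bch x y) = bch (φ x) (φ y) := fun x y =>
    congrArg ExpGroup.log (map_mul F (ExpGroup.exp x) (ExpGroup.exp y))
  obtain ⟨hadd, hlie⟩ := map_add_and_map_lie_of_map_bch hφ hmul
  exact ⟨{ toFun := φ, map_add' := hadd, map_smul' := map_smul_of_map_bch hφ hmul
           map_lie' := fun {x y} => hlie x y }, fun _ => rfl⟩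

/-! ### The filtration of the graded Lie algebra -/

theorem lcsTerm_succ_le {𝔤 : Type*} [LieRing 𝔤] [LieAlgebra ℝ 𝔤] {i : ℕ} {W : Submodule ℝ 𝔤}
    (h : ∀ x : 𝔤, ∀ y ∈ lcsTerm 𝔤 i, ⁅x, y⁆ ∈ W) : lcsTerm 𝔤 (i + 1) ≤ W := by
  rw [lcsTerm, LieModule.lowerCentralSeries_succ, LieSubmodule.lieIdeal_oper_eq_linear_span',
    Submodule.span_le]
  rintro _ ⟨x, -, y, hy, rfl⟩
  exact h x y hy

namespace GradedLie

variable {𝔤 : Type*} [LieRing 𝔤] [LieAlgebra ℝ 𝔤]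

/-- The projection of `𝔤_∞` to a layer. -/
noncomputable def proj (𝔤 : Type*) [LieRing 𝔤] [LieAlgebra ℝ 𝔤] (i : ℕ) :
    GradedLie 𝔤 →ₗ[ℝ] GrLayer 𝔤 i :=
  DirectSum.component ℝ ℕ (fun i => GrLayer 𝔤 i) i

theorem proj_incl_self (i : ℕ) (x : GrLayer 𝔤 i) : proj 𝔤 i (incl 𝔤 i x) = x :=
  DirectSum.component.lof_self ℝ i x

theorem proj_incl_of_ne {i j : ℕ} (h : i ≠ j) (x : GrLayer 𝔤 i) : proj 𝔤 j (incl 𝔤 i x) = 0 :=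
  DFinsupp.single_eq_of_ne h.symm

theorem ext_proj {x y : GradedLie 𝔤} (h : ∀ i, proj 𝔤 i x = proj 𝔤 i y) : x = y :=
  DFinsupp.ext h

theorem lie_incl (i j : ℕ) (x : lcsTerm 𝔤 i) (y : lcsTerm 𝔤 j) :
    ⁅incl 𝔤 i (grMk i x), incl 𝔤 j (grMk j y)⁆ = incl 𝔤 (i + j + 1)
      (grMk (i + j + 1) ⟨⁅(x : 𝔤), (y : 𝔤)⁆, lcsTerm_lie i j x.2 y.2⟩) :=
  bracket_incl i j x y

/-- The elements of `𝔤_∞` whose components in the first `i` layers vanish. -/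
noncomputable def fil (𝔤 : Type*) [LieRing 𝔤] [LieAlgebra ℝ 𝔤] (i : ℕ) :
    Submodule ℝ (GradedLie 𝔤) :=
  ⨅ j ∈ Finset.range i, LinearMap.ker (proj 𝔤 j)

theorem mem_fil {i : ℕ} {x : GradedLie 𝔤} : x ∈ fil 𝔤 i ↔ ∀ j < i, proj 𝔤 j x = 0 := by
  simp [fil]

theorem fil_antitone : Antitone (fil 𝔤) := fun _ _ h _ hx =>
  mem_fil.mpr fun _ hk => mem_fil.mp hx _ (hk.trans_le h)

theorem incl_mem_fil {i j : ℕ} (h : i ≤ j) (x : GrLayer 𝔤 j) : incl 𝔤 j x ∈ fil 𝔤 i :=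
  mem_fil.mpr fun _ hk => proj_incl_of_ne (hk.trans_le h).ne' x

theorem mem_fil_zero (x : GradedLie 𝔤) : x ∈ fil 𝔤 0 :=
  mem_fil.mpr fun _ h => absurd h (Nat.not_lt_zero _)

theorem sub_incl_proj_mem_fil {i : ℕ} {x : GradedLie 𝔤} (hx : x ∈ fil 𝔤 i) :
    x - incl 𝔤 i (proj 𝔤 i x) ∈ fil 𝔤 (i + 1) := by
  refine mem_fil.mpr fun j hj => ?_
  rw [map_sub]
  obtain rfl | h := eq_or_ne i j
  · rw [proj_incl_self, sub_self]
  · rw [proj_incl_of_ne h, mem_fil.mp hx j (by omega), sub_zero]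

theorem fil_le {i : ℕ} {W : Submodule ℝ (GradedLie 𝔤)}
    (h : ∀ j, i ≤ j → ∀ x : lcsTerm 𝔤 j, incl 𝔤 j (grMk j x) ∈ W) : fil 𝔤 i ≤ W := by
  classical
  intro x hx
  have hsum : ∑ j ∈ DFinsupp.support x, incl 𝔤 j (proj 𝔤 j x) = x :=
    DirectSum.sum_support_of (β := fun i => GrLayer 𝔤 i) x
  rw [← hsum]
  refine Submodule.sum_mem _ fun j _ => ?_
  obtain hj | hj := lt_or_ge j i
  · rw [mem_fil.mp hx j hj, map_zero]
    exact W.zero_mem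
  · obtain ⟨z, hz⟩ := grMk_surjective j (proj 𝔤 j x)
    rw [← hz]
    exact h j hj z

theorem lie_mem_fil {i j : ℕ} {x y : GradedLie 𝔤} (hx : x ∈ fil 𝔤 i) (hy : y ∈ fil 𝔤 j) :
    ⁅x, y⁆ ∈ fil 𝔤 (i + j + 1) := by
  have h1 : ∀ k, i ≤ k → ∀ z : lcsTerm 𝔤 k,
      fil 𝔤 j ≤ (fil 𝔤 (i + j + 1)).comap (bracket 𝔤 (incl 𝔤 k (grMk k z))) := by
    intro k hk z
    refine fil_le fun l hl w => ?_
    rw [Submodule.mem_comap, bracket_incl]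
    exact incl_mem_fil (by omega) _
  have h2 : fil 𝔤 i ≤ (fil 𝔤 (i + j + 1)).comap ((bracket 𝔤).flip y) :=
    fil_le fun k hk z => h1 k hk z hy
  exact h2 hx

/-- A bracket raises the degree by at least one. This inclusion transfers statements about `bch`
modulo the lower central series to the grading. -/
theorem lcsTerm_le_fil (i : ℕ) : lcsTerm (GradedLie 𝔤) i ≤ fil 𝔤 i := by
  induction i with
  | zero => exact fun x _ => mem_fil_zero x
  | succ i ih =>
    refine lcsTerm_succ_le fun x y hy => ?_
    simpa using lie_mem_fil (mem_fil_zero x) (ih hy)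

theorem proj_eq_zero_of_lcsTerm_eq_bot {i : ℕ} (h : lcsTerm 𝔤 i = ⊥) (x : GrLayer 𝔤 i) :
    x = 0 := by
  obtain ⟨z, rfl⟩ := grMk_surjective i x
  have hz : z = 0 := Subtype.ext ((Submodule.mem_bot ℝ).mp (h ▸ z.2))
  rw [hz, map_zero]

theorem fil_eq_bot [LieRing.IsNilpotent 𝔤] {i : ℕ} (hi : LieModule.nilpotencyLength 𝔤 𝔤 ≤ i) :
    fil 𝔤 i = ⊥ := by
  refine (Submodule.eq_bot_iff _).mpr fun x hx => ext_proj fun j => ?_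
  rw [map_zero]
  obtain hj | hj := lt_or_ge j i
  · exact mem_fil.mp hx j hj
  · exact proj_eq_zero_of_lcsTerm_eq_bot (lcsTerm_eq_bot (hi.trans hj)) _

instance [LieRing.IsNilpotent 𝔤] : LieRing.IsNilpotent (GradedLie 𝔤) := by
  refine (LieModule.isNilpotent_iff ℝ _ _).mpr ⟨LieModule.nilpotencyLength 𝔤 𝔤, ?_⟩
  have h := (lcsTerm_le_fil (𝔤 := 𝔤) (LieModule.nilpotencyLength 𝔤 𝔤)).trans (fil_eq_bot le_rfl).le
  have h' : (LieModule.lowerCentralSeries ℝ (GradedLie 𝔤) (GradedLie 𝔤)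
      (LieModule.nilpotencyLength 𝔤 𝔤)).toSubmodule = ⊥ := le_bot_iff.mp h
  simpa using h'

instance [LieRing.IsNilpotent 𝔤] [FiniteDimensional ℝ 𝔤] : FiniteDimensional ℝ (GradedLie 𝔤) := by
  refine FiniteDimensional.of_injective (LinearMap.pi fun i :
    Fin (LieModule.nilpotencyLength 𝔤 𝔤) => proj 𝔤 i) fun x y h => ext_proj fun i => ?_
  obtain hi | hi := lt_or_ge i (LieModule.nilpotencyLength 𝔤 𝔤)
  · exact congrFun h ⟨i, hi⟩
  · have := proj_eq_zero_of_lcsTerm_eq_bot (lcsTerm_eq_bot hi)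
    rw [this (proj 𝔤 i x), this (proj 𝔤 i y)]

/-- The graded algebra is generated in degree one: each further layer is spanned by brackets of the
first layer with the preceding one. -/
theorem incl_succ_mem {i : ℕ} {V : Submodule ℝ (GradedLie 𝔤)}
    (h : ∀ x y, ⁅incl 𝔤 0 x, incl 𝔤 i y⁆ ∈ V) (z : GrLayer 𝔤 (i + 1)) :
    incl 𝔤 (i + 1) z ∈ V := by
  obtain ⟨z, rfl⟩ := grMk_surjective _ z
  -- Classes exist only for elements of `lcsTerm 𝔤 (i + 1)`, so the elements whose class lands in
  -- `V` are pushed forward to `𝔤` before testing on brackets.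
  have hle : lcsTerm 𝔤 (i + 1) ≤
      (V.comap (incl 𝔤 (i + 1) ∘ₗ grMk (i + 1))).map (lcsTerm 𝔤 (i + 1)).subtype := by
    refine lcsTerm_succ_le fun x y hy => ?_
    have hxy := lie_mem_lcsTerm_succ_right x hy
    refine ⟨⟨⁅x, y⁆, hxy⟩, ?_, rfl⟩
    have h' := h (grMk 0 ⟨x, mem_lcsTerm_zero x⟩) (grMk i ⟨y, hy⟩)
    rw [lie_incl, incl_congr (show 0 + i + 1 = i + 1 by omega) _ _ hxy] at h'
    exact h'
  obtain ⟨z', hz', hzz'⟩ := hle z.2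
  rw [← Subtype.ext hzz']
  exact hz'

theorem lie_incl_zero_mem_range {i : ℕ} (x : GrLayer 𝔤 0) (y : GrLayer 𝔤 i) :
    ⁅incl 𝔤 0 x, incl 𝔤 i y⁆ ∈ LinearMap.range (incl 𝔤 (i + 1)) := by
  obtain ⟨x, rfl⟩ := grMk_surjective _ x
  obtain ⟨y, rfl⟩ := grMk_surjective _ y
  rw [lie_incl, incl_congr (show 0 + i + 1 = i + 1 by omega) _ _
    (lie_mem_lcsTerm_succ_right _ y.2)]
  exact ⟨_, rfl⟩

section hom

variable {𝔥 : Type*} [LieRing 𝔥] [LieAlgebra ℝ 𝔥] (f : GradedLie 𝔤 →ₗ⁅ℝ⁆ GradedLie 𝔥)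

/-- A generator of the first layer may acquire components of any degree, but never of lower degree;
generation in degree one extends this to all layers. -/
theorem map_incl_mem_fil (i : ℕ) (x : GrLayer 𝔤 i) : f (incl 𝔤 i x) ∈ fil 𝔥 i := by
  induction i with
  | zero => exact mem_fil_zero _
  | succ i ih =>
    refine incl_succ_mem (V := (fil 𝔥 (i + 1)).comap (f : GradedLie 𝔤 →ₗ[ℝ] GradedLie 𝔥))
      (fun a b => ?_) x
    simpa using lie_mem_fil (mem_fil_zero (f (incl 𝔤 0 a))) (ih b)

theorem map_mem_fil {i : ℕ} {x : GradedLie 𝔤} (hx : x ∈ fil 𝔤 i) : f x ∈ fil 𝔥 i := by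
  have h : fil 𝔤 i ≤ (fil 𝔥 i).comap (f : GradedLie 𝔤 →ₗ[ℝ] GradedLie 𝔥) :=
    fil_le fun j hj y => fil_antitone hj (map_incl_mem_fil f j _)
  exact h hx

/-- The map induced on the layers by a homomorphism of the graded Lie algebras. -/
noncomputable def layerMap (i : ℕ) : GrLayer 𝔤 i →ₗ[ℝ] GrLayer 𝔥 i :=
  proj 𝔥 i ∘ₗ (f : GradedLie 𝔤 →ₗ[ℝ] GradedLie 𝔥) ∘ₗ incl 𝔤 i

theorem proj_map_of_mem_fil {i : ℕ} {x : GradedLie 𝔤} (hx : x ∈ fil 𝔤 i) :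
    proj 𝔥 i (f x) = layerMap f i (proj 𝔤 i x) := by
  have h := mem_fil.mp (map_mem_fil f (sub_incl_proj_mem_fil hx)) i (Nat.lt_succ_self i)
  rw [map_sub, map_sub, sub_eq_zero] at h
  exact h

variable {f}

/-- Lift both entries of a bracket `[a, b]`, with `a` in the first layer, up to terms of higher
degree. The bracket of the lifts is then a lift of `[a, b]` up to terms of higher degree. -/
theorem exists_map_incl_sub_mem_fil (hf : Function.Surjective (layerMap f 0)) (i : ℕ)
    (v : GrLayer 𝔥 i) : ∃ y : GrLayer 𝔤 i, f (incl 𝔤 i y) - incl 𝔥 i v ∈ fil 𝔥 (i + 1) := by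
  induction i with
  | zero =>
    obtain ⟨y, rfl⟩ := hf v
    exact ⟨y, sub_incl_proj_mem_fil (mem_fil_zero _)⟩
  | succ i ih =>
    have h := incl_succ_mem (V := (LinearMap.range (incl 𝔤 (i + 1))).map
      (f : GradedLie 𝔤 →ₗ[ℝ] GradedLie 𝔥) ⊔ fil 𝔥 (i + 1 + 1)) (fun a b => ?_) v
    · obtain ⟨_, ⟨_, ⟨y, rfl⟩, rfl⟩, r, hr, h⟩ := Submodule.mem_sup.mp h
      refine ⟨y, ?_⟩
      rw [← h]
      simpa using hr
    · obtain ⟨y, rfl⟩ := hf a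
      obtain ⟨z, hz⟩ := ih b
      have hy := sub_incl_proj_mem_fil (mem_fil_zero (f (incl 𝔤 0 y)))
      refine Submodule.mem_sup.mpr ⟨f ⁅incl 𝔤 0 y, incl 𝔤 i z⁆,
        ⟨_, lie_incl_zero_mem_range y z, rfl⟩, _, ?_, add_sub_cancel _ _⟩
      have e : ⁅incl 𝔥 0 (layerMap f 0 y), incl 𝔥 i b⁆ - f ⁅incl 𝔤 0 y, incl 𝔤 i z⁆ =
          -(⁅f (incl 𝔤 0 y) - incl 𝔥 0 (layerMap f 0 y), f (incl 𝔤 i z)⁆ +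
            ⁅incl 𝔥 0 (layerMap f 0 y), f (incl 𝔤 i z) - incl 𝔥 i b⁆) := by
        rw [LieHom.map_lie, sub_lie, lie_sub]
        abel
      rw [e]
      refine neg_mem (add_mem ?_ ?_)
      · refine fil_antitone (show i + 1 + 1 ≤ 0 + 1 + i + 1 by omega)
          (lie_mem_fil hy (map_incl_mem_fil f i z))
      · simpa using lie_mem_fil (mem_fil_zero (incl 𝔥 0 (layerMap f 0 y))) hz

theorem layerMap_surjective (hf : Function.Surjective (layerMap f 0)) (i : ℕ) :
    Function.Surjective (layerMap f i) := by
  intro v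
  obtain ⟨y, hy⟩ := exists_map_incl_sub_mem_fil hf i v
  refine ⟨y, ?_⟩
  have h := mem_fil.mp hy i (Nat.lt_succ_self i)
  rw [map_sub, proj_incl_self, sub_eq_zero] at h
  exact h

/-- Successive approximation: lift the lowest component and treat the remainder, which lies one
layer deeper. The counter `n` bounds the number of layers left. -/
theorem surjective_of_layerMap [LieRing.IsNilpotent 𝔥]
    (hf : Function.Surjective (layerMap f 0)) : Function.Surjective f := by
  have h : ∀ n i, LieModule.nilpotencyLength 𝔥 𝔥 ≤ i + n → ∀ v ∈ fil 𝔥 i, ∃ x, f x = v := by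
    intro n
    induction n with
    | zero =>
      intro i hi v hv
      rw [fil_eq_bot (i := i) hi, Submodule.mem_bot] at hv
      exact ⟨0, by rw [hv, map_zero]⟩
    | succ n ih =>
      intro i hi v hv
      obtain ⟨y, hy⟩ := exists_map_incl_sub_mem_fil hf i (proj 𝔥 i v)
      obtain ⟨x, hx⟩ := ih (i + 1) (by omega) _ (sub_mem (sub_incl_proj_mem_fil hv) hy)
      refine ⟨x + incl 𝔤 i y, ?_⟩
      rw [map_add, hx]
      abel
  exact fun v => h _ 0 (Nat.le_add_left _ _) v (mem_fil_zero v)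

/-- The lowest component of an element of the kernel is in the kernel of its layer map, so the
element moves down the filtration until it is zero. -/
theorem injective_of_layerMap [LieRing.IsNilpotent 𝔤]
    (hf : ∀ i, Function.Injective (layerMap f i)) : Function.Injective f := by
  refine (injective_iff_map_eq_zero f).mpr fun x hx => ?_
  have h : ∀ i, x ∈ fil 𝔤 i := by
    intro i
    induction i with
    | zero => exact mem_fil_zero x
    | succ i ih =>
      have h0 : layerMap f i (proj 𝔤 i x) = 0 := by
        rw [← proj_map_of_mem_fil f ih, hx, map_zero]
      have h1 := sub_incl_proj_mem_fil ih
      rwa [(injective_iff_map_eq_zero _).mp (hf i) _ h0, map_zero, sub_zero] at h1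
  simpa [fil_eq_bot le_rfl] using h (LieModule.nilpotencyLength 𝔤 𝔤)

/-- A homomorphism of graded Lie algebras with the same homogeneous dimension is bijective if it is
surjective on the first layer. -/
theorem bijective_of_layerMap [LieRing.IsNilpotent 𝔤] [LieRing.IsNilpotent 𝔥]
    [FiniteDimensional ℝ 𝔤] [FiniteDimensional ℝ 𝔥] (hf : Function.Surjective (layerMap f 0))
    {m : ℕ} (hg : LieModule.nilpotencyLength 𝔤 𝔤 ≤ m)
    (hdim : ∑ i ∈ Finset.range m, (i + 1) * Module.finrank ℝ (GrLayer 𝔤 i) =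
      ∑ i ∈ Finset.range m, (i + 1) * Module.finrank ℝ (GrLayer 𝔥 i)) :
    Function.Bijective f := by
  have hle : ∀ i, Module.finrank ℝ (GrLayer 𝔥 i) ≤ Module.finrank ℝ (GrLayer 𝔤 i) := fun i =>
    LinearMap.finrank_le_finrank_of_surjective (layerMap_surjective hf i)
  refine ⟨injective_of_layerMap fun i => ?_, surjective_of_layerMap hf⟩
  obtain hi | hi := lt_or_ge i m
  -- Termwise inequalities between equal sums are equalities, and the weight `i + 1` is positive.
  · have h := (Finset.sum_eq_sum_iff_of_le fun j _ => Nat.mul_le_mul_left (j + 1) (hle j)).mp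
      hdim.symm i (Finset.mem_range.mpr hi)
    have h' := Nat.eq_of_mul_eq_mul_left (Nat.succ_pos i) h
    exact (LinearMap.injective_iff_surjective_of_finrank_eq_finrank h'.symm).mpr
      (layerMap_surjective hf i)
  · intro x y _
    rw [proj_eq_zero_of_lcsTerm_eq_bot (lcsTerm_eq_bot (hg.trans hi)) x,
      proj_eq_zero_of_lcsTerm_eq_bot (lcsTerm_eq_bot (hg.trans hi)) y]

end hom

end GradedLie

/-! ### Norms on finite-dimensional spaces -/

theorem Seminorm.exists_abs_le_mul {V : Type*} [AddCommGroup V] [Module ℝ V]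
    [FiniteDimensional ℝ V] (N : Seminorm ℝ V) (hN : ∀ v, N v = 0 → v = 0) (φ : V →ₗ[ℝ] ℝ) :
    ∃ C, 0 ≤ C ∧ ∀ v, |φ v| ≤ C * N v := by
  let _ : NormedAddCommGroup V := AddGroupNorm.toNormedAddCommGroup
    { N.toAddGroupSeminorm with eq_zero_of_map_eq_zero' := hN }
  let _ : NormedSpace ℝ V := ⟨fun a b => (map_smul_eq_mul N a b).le⟩
  exact ⟨‖LinearMap.toContinuousLinearMap φ‖, norm_nonneg _,
    (LinearMap.toContinuousLinearMap φ).le_opNorm⟩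

theorem Seminorm.exists_le_mul {V : Type*} [AddCommGroup V] [Module ℝ V]
    [FiniteDimensional ℝ V] (N : Seminorm ℝ V) (hN : ∀ v, N v = 0 → v = 0) (p : Seminorm ℝ V) :
    ∃ C, 0 ≤ C ∧ ∀ v, p v ≤ C * N v := by
  let b := Module.finBasis ℝ V
  choose C hC hCN using fun i => N.exists_abs_le_mul hN (b.coord i)
  refine ⟨∑ i, C i * p (b i), Finset.sum_nonneg fun i _ => mul_nonneg (hC i) (apply_nonneg p _),
    fun v => ?_⟩
  calc p v = p (∑ i, b.repr v i • b i) := by rw [b.sum_repr]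
    _ ≤ ∑ i, p (b.repr v i • b i) := Finset.le_sum_of_subadditive p (map_zero p).le
        (map_add_le_add p) _ _
    _ ≤ ∑ i, C i * p (b i) * N v := Finset.sum_le_sum fun i _ => by
        rw [map_smul_eq_mul, mul_right_comm]
        exact mul_le_mul_of_nonneg_right (hCN i v) (apply_nonneg p _)
    _ = _ := (Finset.sum_mul _ _ _).symm

/-- A nonzero linear form has a positive multiple of dual norm one. -/
theorem Seminorm.exists_isLUB_one {V : Type*} [AddCommGroup V] [Module ℝ V]
    [FiniteDimensional ℝ V] (N : Seminorm ℝ V) (hN : ∀ v, N v = 0 → v = 0) {φ : V →ₗ[ℝ] ℝ}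
    (hφ : φ ≠ 0) : ∃ a : ℝ, IsLUB ((a • φ) '' {v | N v < 1}) 1 := by
  obtain ⟨C, hC, hCN⟩ := N.exists_abs_le_mul hN φ
  have hbdd : BddAbove (φ '' {v | N v < 1}) := by
    refine ⟨C, ?_⟩
    rintro _ ⟨v, hv, rfl⟩
    calc φ v ≤ C * N v := (le_abs_self _).trans (hCN v)
      _ ≤ C * 1 := mul_le_mul_of_nonneg_left (le_of_lt hv) hC
      _ = C := mul_one C
  have hlub := isLUB_csSup (s := φ '' {v | N v < 1}) ⟨φ 0, 0, by simp, rfl⟩ hbdd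
  -- The dual norm of `φ`; its inverse will be the required factor.
  set M := sSup (φ '' {v | N v < 1})
  have hM : 0 < M := by
    obtain ⟨v, hv⟩ : ∃ v, 0 < φ v := by
      obtain ⟨v, hv⟩ := DFunLike.ne_iff.mp hφ
      rcases lt_or_gt_of_ne hv with h | h
      · exact ⟨-v, by simpa using h⟩
      · exact ⟨v, by simpa using h⟩
    have hpos : 0 < (N v + 1)⁻¹ := inv_pos.mpr (by positivity)
    refine lt_of_lt_of_le (mul_pos hpos hv) (hlub.1 ⟨(N v + 1)⁻¹ • v, ?_, by simp⟩)
    rw [Set.mem_ofPred_eq, map_smul_eq_mul, Real.norm_of_nonneg hpos.le,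
      inv_mul_lt_one₀ (by positivity)]
    exact lt_add_one _
  refine ⟨M⁻¹, ?_, fun b hb => ?_⟩
  · rintro _ ⟨v, hv, rfl⟩
    rw [LinearMap.smul_apply, smul_eq_mul, inv_mul_le_one₀ hM]
    exact hlub.1 ⟨v, hv, rfl⟩
  · have h : M ≤ M * b := hlub.2 (by
      rintro _ ⟨v, hv, rfl⟩
      have := hb ⟨v, hv, rfl⟩
      rw [LinearMap.smul_apply, smul_eq_mul, inv_mul_le_iff₀ hM] at this
      exact this)
    nlinarith

theorem Seminorm.abs_le_of_upperBound {V : Type*} [AddCommGroup V] [Module ℝ V]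
    (N : Seminorm ℝ V) {φ : V →ₗ[ℝ] ℝ} (h : 1 ∈ upperBounds (φ '' {v | N v < 1})) (v : V) :
    |φ v| ≤ N v := by
  have key : ∀ v, φ v ≤ N v := by
    refine fun v => le_of_forall_pos_lt_add fun ε hε => ?_
    have hs : 0 < N v + ε / 2 := by positivity
    have h1 := h ⟨(N v + ε / 2)⁻¹ • v, (by
      rw [Set.mem_ofPred_eq, map_smul_eq_mul, Real.norm_of_nonneg (inv_nonneg.mpr hs.le),
        inv_mul_lt_one₀ hs]
      linarith), rfl⟩
    rw [map_smul, smul_eq_mul, inv_mul_le_one₀ hs] at h1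
    linarith
  refine abs_le.mpr ⟨?_, key v⟩
  have := key (-v)
  rw [map_neg, map_neg_eq_map] at this
  linarith

/-! ### Linear forms on the first layer and the Carnot–Carathéodory unit ball -/

section CarnotCaratheodory

variable {𝔤 : Type*} [LieRing 𝔤] [LieAlgebra ℝ 𝔤] [LieRing.IsNilpotent 𝔤]

/-- The correction to `x + y` consists of commutators, which have no component in the first layer.
-/
theorem GradedLie.proj_zero_bch (x y : GradedLie 𝔤) :
    GradedLie.proj 𝔤 0 (bch x y) = GradedLie.proj 𝔤 0 x + GradedLie.proj 𝔤 0 y := by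
  have h := GradedLie.mem_fil.mp (GradedLie.lcsTerm_le_fil 1 (bch_sub_add_mem_one x y)) 0 one_pos
  rwa [map_sub, sub_eq_zero, map_add] at h

/-- The function `φ ∘ proj 0 ∘ log ∘ γ` is absolutely continuous and has derivative `φ (u t)` almost
everywhere, so its increment is the integral of a function bounded by `N (u t)`. -/
theorem IsHorizontalCurve.enorm_sub_le {N : Seminorm ℝ (GrLayer 𝔤 0)} {φ : GrLayer 𝔤 0 →ₗ[ℝ] ℝ}
    (hφ : ∀ v, |φ v| ≤ N v) {γ : ℝ → CarnotCompletion 𝔤} {u : ℝ → GrLayer 𝔤 0}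
    (h : IsHorizontalCurve γ u) :
    ‖φ (GradedLie.proj 𝔤 0 (γ 1).log) - φ (GradedLie.proj 𝔤 0 (γ 0).log)‖ₑ ≤
      ∫⁻ t in Set.Ioo (0 : ℝ) 1, ENNReal.ofReal (N (u t)) := by
  have hac := h.1 (φ ∘ₗ GradedLie.proj 𝔤 0)
  rw [← LinearMap.comp_apply, ← LinearMap.comp_apply, ← hac.integral_deriv_eq_sub,
    intervalIntegral.integral_of_le zero_le_one, MeasureTheory.integral_Ioc_eq_integral_Ioo]
  refine (MeasureTheory.enorm_integral_le_lintegral_enorm _).trans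
    (MeasureTheory.lintegral_mono_ae ?_)
  filter_upwards [h.2] with t ht
  have hd := ht (φ ∘ₗ GradedLie.proj 𝔤 0)
  have hd' : HasDerivAt (fun s => (φ ∘ₗ GradedLie.proj 𝔤 0) (γ s).log) (φ (u t)) t := by
    -- In the first layer, left translation by `(γ t)⁻¹` is subtraction of a constant.
    have he : (fun s : ℝ => (φ ∘ₗ GradedLie.proj 𝔤 0) ((γ t)⁻¹ * γ (t + s)).log) =
        fun s => (φ ∘ₗ GradedLie.proj 𝔤 0) (γ (t + s)).log -
          (φ ∘ₗ GradedLie.proj 𝔤 0) (γ t).log := by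
      funext s
      change φ (GradedLie.proj 𝔤 0 (bch (-(γ t).log) (γ (t + s)).log)) = _
      rw [GradedLie.proj_zero_bch, map_neg, map_add, map_neg, neg_add_eq_sub]
      rfl
    rw [he, hasDerivAt_sub_const_iff, LinearMap.comp_apply, GradedLie.proj_incl_self] at hd
    have h2 := HasDerivAt.comp_sub_const (f := fun s => (φ ∘ₗ GradedLie.proj 𝔤 0) (γ (t + s)).log)
      t t (by simpa using hd)
    simpa using h2
  rw [hd'.deriv, Real.enorm_eq_ofReal_abs]
  exact ENNReal.ofReal_le_ofReal (hφ _)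

/-- The one-parameter subgroup `t ↦ exp (t v)` is horizontal with constant velocity `v`. -/
theorem ccDist_one_exp_incl_le (N : Seminorm ℝ (GrLayer 𝔤 0)) (v : GrLayer 𝔤 0) :
    ccDist N 1 (ExpGroup.exp (GradedLie.incl 𝔤 0 v)) ≤ ENNReal.ofReal (N v) := by
  have hcurve : IsHorizontalCurve (fun t : ℝ => ExpGroup.exp (t • GradedLie.incl 𝔤 0 v))
      (fun _ => v) := by
    refine ⟨fun f => ?_, Filter.Eventually.of_forall fun t f => ?_⟩
    · have hl : LipschitzOnWith (Real.nnabs (f (GradedLie.incl 𝔤 0 v)))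
          (fun t : ℝ => f (t • GradedLie.incl 𝔤 0 v)) (Set.uIcc 0 1) := by
        refine LipschitzOnWith.of_dist_le_mul fun s _ t _ => ?_
        rw [Real.dist_eq, Real.dist_eq, ← map_sub, ← sub_smul, map_smul, smul_eq_mul, abs_mul,
          mul_comm]
        rfl
      exact hl.absolutelyContinuousOnInterval
    · have he : (fun s : ℝ => f ((ExpGroup.exp (t • GradedLie.incl 𝔤 0 v))⁻¹ *
          ExpGroup.exp ((t + s) • GradedLie.incl 𝔤 0 v)).log) =
          fun s => s * f (GradedLie.incl 𝔤 0 v) := by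
        funext s
        change f (bch (-(t • GradedLie.incl 𝔤 0 v)) ((t + s) • GradedLie.incl 𝔤 0 v)) = _
        rw [← neg_smul, bch_smul_smul, neg_add_cancel_left, map_smul, smul_eq_mul]
      rw [he]
      simpa using (hasDerivAt_id (0 : ℝ)).mul_const (f (GradedLie.incl 𝔤 0 v))
  refine (iInf₂_le_of_le _ _ (iInf₂_le_of_le hcurve ?_ (iInf_le_of_le ?_ le_rfl))).trans ?_
  · rw [zero_smul]
    rfl
  · rw [one_smul]
  · simp

/-- The form grows no faster than length along horizontal curves, which gives the upper bound.
Exponentials of vectors of the first layer show that it is sharp. -/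
theorem isLUB_image_ccBall {N : Seminorm ℝ (GrLayer 𝔤 0)} {φ : GrLayer 𝔤 0 →ₗ[ℝ] ℝ}
    (h : IsLUB (φ '' {v | N v < 1}) 1) :
    IsLUB ((fun g : CarnotCompletion 𝔤 => φ (GradedLie.proj 𝔤 0 g.log)) ''
      {g | ccDist N 1 g < 1}) 1 := by
  have hφ := N.abs_le_of_upperBound h.1
  refine ⟨?_, fun b hb => h.2 ?_⟩
  · rintro _ ⟨g, hg, rfl⟩
    rw [Set.mem_ofPred_eq, ccDist] at hg
    simp only [iInf_lt_iff] at hg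
    obtain ⟨γ, u, hγ, h0, h1, hlt⟩ := hg
    have hle := (hγ.enorm_sub_le hφ).trans_lt hlt
    rw [h0, h1, show (1 : CarnotCompletion 𝔤).log = 0 from rfl, map_zero, map_zero, sub_zero,
      Real.enorm_eq_ofReal_abs, ENNReal.ofReal_lt_one] at hle
    exact (le_abs_self _).trans hle.le
  · rintro _ ⟨v, hv, rfl⟩
    refine hb ⟨ExpGroup.exp (GradedLie.incl 𝔤 0 v), ?_, ?_⟩
    · exact (ccDist_one_exp_incl_le N v).trans_lt (ENNReal.ofReal_lt_one.mpr hv)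
    · exact congrArg φ (GradedLie.proj_incl_self 0 v)

end CarnotCaratheodory

theorem ExpGroup.continuous_exp_linearMap {𝔤 𝔥 : Type*} [LieRing 𝔤] [LieAlgebra ℝ 𝔤]
    [LieRing 𝔥] [LieAlgebra ℝ 𝔥] (T : 𝔤 →ₗ[ℝ] 𝔥) :
    Continuous fun g : ExpGroup 𝔤 => ExpGroup.exp (T g.log) := by
  let _ : TopologicalSpace 𝔤 := moduleTopology ℝ 𝔤
  let _ : TopologicalSpace 𝔥 := moduleTopology ℝ 𝔥
  have : IsModuleTopology ℝ 𝔤 := ⟨rfl⟩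
  have : IsModuleTopology ℝ 𝔥 := ⟨rfl⟩
  have : ContinuousAdd 𝔥 := IsModuleTopology.toContinuousAdd ℝ 𝔥
  exact continuous_induced_rng.mpr
    ((IsModuleTopology.continuous_of_linearMap T).comp continuous_induced_dom)

theorem ExpGroup.continuous_linearForm {𝔤 : Type*} [LieRing 𝔤] [LieAlgebra ℝ 𝔤]
    (T : 𝔤 →ₗ[ℝ] ℝ) : Continuous fun g : ExpGroup 𝔤 => T g.log := by
  let _ : TopologicalSpace 𝔤 := moduleTopology ℝ 𝔤
  have : IsModuleTopology ℝ 𝔤 := ⟨rfl⟩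
  exact (IsModuleTopology.continuous_of_linearMap T).comp continuous_induced_dom

/-- The dichotomy for continuous homomorphisms of Carnot completions of the same homogeneous
dimension. -/
theorem CarnotCompletion.equiv_or_exists_form {𝔤 𝔥 : Type*} [LieRing 𝔤] [LieAlgebra ℝ 𝔤]
    [LieRing 𝔥] [LieAlgebra ℝ 𝔥] [LieRing.IsNilpotent 𝔤] [LieRing.IsNilpotent 𝔥]
    [FiniteDimensional ℝ 𝔤] [FiniteDimensional ℝ 𝔥] {m : ℕ}
    (hg : LieModule.nilpotencyLength 𝔤 𝔤 ≤ m)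
    (hdim : ∑ i ∈ Finset.range m, (i + 1) * Module.finrank ℝ (GrLayer 𝔤 i) =
      ∑ i ∈ Finset.range m, (i + 1) * Module.finrank ℝ (GrLayer 𝔥 i))
    (N : Seminorm ℝ (GrLayer 𝔥 0)) (hN : ∀ v, N v = 0 → v = 0)
    (F : CarnotCompletion 𝔤 →ₙ* CarnotCompletion 𝔥) (hF : Continuous F) :
    (∃ e : CarnotCompletion 𝔤 ≃ₜ* CarnotCompletion 𝔥, ∀ x, e x = F x) ∨
    ∃ l : CarnotCompletion 𝔥 → ℝ, Continuous l ∧ (∀ x y, l (x * y) = l x + l y) ∧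
      (∀ x, l (F x) = 0) ∧ IsLUB (l '' {h | ccDist N 1 h < 1}) 1 := by
  obtain ⟨f, hf⟩ := exists_lieHom_of_continuous F hF
  by_cases hs : Function.Surjective (GradedLie.layerMap f 0)
  · left
    have hbij := GradedLie.bijective_of_layerMap hs hg hdim
    let e := LinearEquiv.ofBijective (f : GradedLie 𝔤 →ₗ[ℝ] GradedLie 𝔥) hbij
    have hFe : ∀ x, F x = ExpGroup.exp (e x.log) := fun x => ExpGroup.ext (hf x)
    refine ⟨{ toFun := F
              invFun := fun y => ExpGroup.exp (e.symm y.log)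
              left_inv := fun x => ?_
              right_inv := fun y => ?_
              map_mul' := map_mul F
              continuous_toFun := hF
              continuous_invFun := ?_ }, fun _ => rfl⟩
    · rw [hFe]
      exact ExpGroup.ext (e.symm_apply_apply _)
    · rw [hFe]
      exact ExpGroup.ext (e.apply_symm_apply _)
    · exact ExpGroup.continuous_exp_linearMap e.symm.toLinearMap
  · right
    rw [← LinearMap.range_eq_top] at hs
    -- The image in the first layer is a proper subspace, so a nonzero linear form vanishes on it.
    obtain ⟨ψ, hψ, hψf⟩ := Submodule.exists_le_ker_of_lt_top _ (lt_top_iff_ne_top.mpr hs)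
    obtain ⟨a, ha⟩ := N.exists_isLUB_one hN hψ
    refine ⟨fun g => (a • ψ) (GradedLie.proj 𝔥 0 g.log), ?_, fun x y => ?_, fun x => ?_,
      isLUB_image_ccBall ha⟩
    · exact ExpGroup.continuous_linearForm ((a • ψ) ∘ₗ GradedLie.proj 𝔥 0)
    · change (a • ψ) (GradedLie.proj 𝔥 0 (bch x.log y.log)) = _
      rw [GradedLie.proj_zero_bch, map_add]
    · have h : ψ (GradedLie.layerMap f 0 (GradedLie.proj 𝔤 0 x.log)) = 0 := hψf ⟨_, rfl⟩
      rw [← GradedLie.proj_map_of_mem_fil f (GradedLie.mem_fil_zero _)] at h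
      simp only [hf, LinearMap.smul_apply, h, smul_zero]

/-! ### Groups with a logarithm -/

section logarithm

variable {Γ 𝔤 : Type*} [Group Γ] [LieRing 𝔤] [LieAlgebra ℝ 𝔤] [LieRing.IsNilpotent 𝔤] {L : Γ → 𝔤}

theorem log_one (hL : ∀ a b, L (a * b) = bch (L a) (L b)) : L 1 = 0 := by
  have h := hL 1 1
  rw [mul_one, bch_self, two_smul] at h
  exact left_eq_add.mp h

theorem log_inv (hL : ∀ a b, L (a * b) = bch (L a) (L b)) (a : Γ) : L a⁻¹ = -L a :=
  eq_neg_of_bch_eq_zero (by rw [← hL, mul_inv_cancel, log_one hL])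

theorem log_pow (hL : ∀ a b, L (a * b) = bch (L a) (L b)) (a : Γ) (n : ℕ) :
    L (a ^ n) = (n : ℝ) • L a := by
  induction n with
  | zero => simp [log_one hL]
  | succ n ih =>
    have h := bch_smul_smul (n : ℝ) 1 (L a)
    rw [one_smul] at h
    rw [pow_succ, hL, ih, h]
    push_cast
    rfl

theorem log_zpow (hL : ∀ a b, L (a * b) = bch (L a) (L b)) (a : Γ) (n : ℤ) :
    L (a ^ n) = (n : ℝ) • L a := by
  obtain ⟨m, rfl | rfl⟩ := n.eq_nat_or_neg
  · rw [zpow_natCast, log_pow hL]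
    rfl
  · rw [zpow_neg, zpow_natCast, log_inv hL, log_pow hL]
    push_cast
    rw [neg_smul]

theorem log_mul_sub_mem_left (hL : ∀ a b, L (a * b) = bch (L a) (L b)) {k : ℕ} {a : Γ}
    (ha : L a ∈ lcsTerm 𝔤 k) (b : Γ) : L (a * b) - (L a + L b) ∈ lcsTerm 𝔤 (k + 1) := by
  rw [hL]
  exact bch_sub_add_mem_left ha _

theorem log_mul_sub_mem_right (hL : ∀ a b, L (a * b) = bch (L a) (L b)) {k : ℕ} (a : Γ) {b : Γ}
    (hb : L b ∈ lcsTerm 𝔤 k) : L (a * b) - (L a + L b) ∈ lcsTerm 𝔤 (k + 1) := by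
  rw [hL]
  exact bch_sub_add_mem_right _ hb

theorem log_mul_mem (hL : ∀ a b, L (a * b) = bch (L a) (L b)) {k : ℕ} {a b : Γ}
    (ha : L a ∈ lcsTerm 𝔤 k) (hb : L b ∈ lcsTerm 𝔤 k) : L (a * b) ∈ lcsTerm 𝔤 k := by
  have h := lcsTerm_antitone 𝔤 (Nat.le_succ k) (log_mul_sub_mem_left hL ha b)
  simpa using add_mem h (add_mem ha hb)

theorem log_inv_mul_mem_iff (hL : ∀ a b, L (a * b) = bch (L a) (L b)) {k : ℕ} {a b : Γ} :
    L (a⁻¹ * b) ∈ lcsTerm 𝔤 k ↔ L b - L a ∈ lcsTerm 𝔤 k := by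
  constructor
  · intro h
    have h1 := lcsTerm_antitone 𝔤 (Nat.le_succ k) (log_mul_sub_mem_right hL a h)
    rw [mul_inv_cancel_left] at h1
    convert add_mem h1 h using 1
    abel
  · intro h
    -- From `a (a⁻¹ b) = b`: once `L (a⁻¹ * b)` lies in the `m`-th term, it equals `L b - L a`
    -- modulo the next one.
    have key : ∀ m ≤ k, L (a⁻¹ * b) ∈ lcsTerm 𝔤 m := by
      intro m
      induction m with
      | zero => exact fun _ => mem_lcsTerm_zero _
      | succ m ih =>
        intro hm
        have h1 := log_mul_sub_mem_right hL a (ih (by omega))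
        rw [mul_inv_cancel_left] at h1
        convert sub_mem (lcsTerm_antitone 𝔤 hm h) h1 using 1
        abel
    exact key k le_rfl

theorem log_list_prod_sub_mem (hL : ∀ a b, L (a * b) = bch (L a) (L b)) {k : ℕ} {l : List Γ}
    (hl : ∀ a ∈ l, L a ∈ lcsTerm 𝔤 k) :
    L l.prod ∈ lcsTerm 𝔤 k ∧ L l.prod - (l.map L).sum ∈ lcsTerm 𝔤 (k + 1) := by
  induction l with
  | nil => simp [log_one hL]
  | cons a l ih =>
    obtain ⟨h1, h2⟩ := ih fun b hb => hl b (List.mem_cons_of_mem a hb)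
    have ha := hl a List.mem_cons_self
    rw [List.prod_cons, List.map_cons, List.sum_cons]
    refine ⟨log_mul_mem hL ha h1, ?_⟩
    convert add_mem (log_mul_sub_mem_left hL ha l.prod) h2 using 1
    abel

open scoped commutatorElement in
-- In `⁅a, g⁆ (g a) = a g` the half brackets of the products `a g` and `g a` have opposite signs, so
-- their difference is the full bracket. Division by `g a` is carried out by climbing the
-- filtration.
theorem log_commutator_sub_mem (hL : ∀ a b, L (a * b) = bch (L a) (L b)) {k : ℕ} (a : Γ) {g : Γ}
    (hg : L g ∈ lcsTerm 𝔤 k) :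
    L ⁅a, g⁆ ∈ lcsTerm 𝔤 (k + 1) ∧ L ⁅a, g⁆ - ⁅L a, L g⁆ ∈ lcsTerm 𝔤 (k + 2) := by
  have hmul : ⁅a, g⁆ * (g * a) = a * g := by
    rw [commutatorElement_def]; group
  have h1 : L (a * g) - (L a + L g + (1 / 2 : ℝ) • ⁅L a, L g⁆) ∈ lcsTerm 𝔤 (k + 2) := by
    rw [hL]
    exact bch_sub_lie_mem false hg
  have h2 : L (g * a) - (L g + L a + (1 / 2 : ℝ) • ⁅L g, L a⁆) ∈ lcsTerm 𝔤 (k + 2) := by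
    rw [hL]
    exact bch_sub_lie_mem true hg
  have h3 : L (a * g) - L (g * a) - ⁅L a, L g⁆ ∈ lcsTerm 𝔤 (k + 2) := by
    convert sub_mem h1 h2 using 1
    rw [← lie_skew (L g) (L a)]
    module
  have hlie : ⁅L a, L g⁆ ∈ lcsTerm 𝔤 (k + 1) := lie_mem_lcsTerm_succ_right _ hg
  have h4 : L (a * g) - L (g * a) ∈ lcsTerm 𝔤 (k + 1) := by
    convert add_mem (lcsTerm_antitone 𝔤 (Nat.le_succ (k + 1)) h3) hlie using 1
    abel
  have key : ∀ m ≤ k + 1, L ⁅a, g⁆ ∈ lcsTerm 𝔤 m := by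
    intro m
    induction m with
    | zero => exact fun _ => mem_lcsTerm_zero _
    | succ m ih =>
      intro hm
      have h := log_mul_sub_mem_left hL (ih (by omega)) (g * a)
      rw [hmul] at h
      convert sub_mem (lcsTerm_antitone 𝔤 hm h4) h using 1
      abel
  refine ⟨key _ le_rfl, ?_⟩
  have h := log_mul_sub_mem_left hL (key _ le_rfl) (g * a)
  rw [hmul] at h
  convert sub_mem h3 h using 1
  abel

end logarithm

/-! ### Projections along the lower central series -/

section projection

variable {𝔤 : Type*} [LieRing 𝔤] [LieAlgebra ℝ 𝔤]

theorem exists_lcsProj (𝔤 : Type*) [LieRing 𝔤] [LieAlgebra ℝ 𝔤] (k : ℕ) :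
    ∃ Q : 𝔤 →ₗ[ℝ] 𝔤, (∀ x, x - Q x ∈ lcsTerm 𝔤 k) ∧ ∀ x ∈ lcsTerm 𝔤 k, Q x = 0 := by
  obtain ⟨P, hP⟩ := (lcsTerm 𝔤 k).subtype.exists_leftInverse_of_injective
    (Submodule.ker_subtype _)
  refine ⟨LinearMap.id - (lcsTerm 𝔤 k).subtype ∘ₗ P, fun x => by simp, fun x hx => ?_⟩
  have h : P x = ⟨x, hx⟩ := LinearMap.congr_fun hP ⟨x, hx⟩
  simp [h]

/-- A linear projection with kernel the `(k+1)`-st term of the lower central series. -/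
noncomputable def lcsProj (𝔤 : Type*) [LieRing 𝔤] [LieAlgebra ℝ 𝔤] (k : ℕ) : 𝔤 →ₗ[ℝ] 𝔤 :=
  (exists_lcsProj 𝔤 k).choose

theorem sub_lcsProj_mem (k : ℕ) (x : 𝔤) : x - lcsProj 𝔤 k x ∈ lcsTerm 𝔤 k :=
  (exists_lcsProj 𝔤 k).choose_spec.1 x

theorem lcsProj_eq_zero_iff {k : ℕ} {x : 𝔤} : lcsProj 𝔤 k x = 0 ↔ x ∈ lcsTerm 𝔤 k :=
  ⟨fun h => by simpa [h] using sub_lcsProj_mem k x, (exists_lcsProj 𝔤 k).choose_spec.2 x⟩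

theorem lcsProj_eq_iff {k : ℕ} {x y : 𝔤} : lcsProj 𝔤 k x = lcsProj 𝔤 k y ↔ x - y ∈ lcsTerm 𝔤 k := by
  rw [← lcsProj_eq_zero_iff, map_sub, sub_eq_zero]

/-- The projections are chosen independently for each index; this order of composition needs only
that their kernels are nested. -/
theorem lcsProj_lcsProj {j k : ℕ} (h : j ≤ k) (x : 𝔤) :
    lcsProj 𝔤 j (lcsProj 𝔤 k x) = lcsProj 𝔤 j x :=
  (lcsProj_eq_iff.mpr (lcsTerm_antitone 𝔤 h (sub_lcsProj_mem k x))).symm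

theorem lcsProj_eq_self [LieRing.IsNilpotent 𝔤] {k : ℕ} (hk : LieModule.nilpotencyLength 𝔤 𝔤 ≤ k)
    (x : 𝔤) : lcsProj 𝔤 k x = x := by
  have h := sub_lcsProj_mem k x
  rw [lcsTerm_eq_bot hk, Submodule.mem_bot, sub_eq_zero] at h
  exact h.symm

/-- The component of degree `k + 1` with respect to the projections `lcsProj`. -/
noncomputable def lcsComp (𝔤 : Type*) [LieRing 𝔤] [LieAlgebra ℝ 𝔤] (k : ℕ) : 𝔤 →ₗ[ℝ] 𝔤 :=
  lcsProj 𝔤 (k + 1) - lcsProj 𝔤 k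

theorem lcsComp_mem (k : ℕ) (x : 𝔤) : lcsComp 𝔤 k x ∈ lcsTerm 𝔤 k := by
  convert sub_mem (sub_lcsProj_mem k x)
    (lcsTerm_antitone 𝔤 (Nat.le_succ k) (sub_lcsProj_mem (k + 1) x)) using 1
  rw [lcsComp, LinearMap.sub_apply]
  abel

theorem lcsComp_eq_zero {j k : ℕ} (h : k < j) {x : 𝔤} (hx : x ∈ lcsTerm 𝔤 j) :
    lcsComp 𝔤 k x = 0 := by
  rw [lcsComp, LinearMap.sub_apply, lcsProj_eq_zero_iff.mpr (lcsTerm_antitone 𝔤 h hx),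
    lcsProj_eq_zero_iff.mpr (lcsTerm_antitone 𝔤 h.le hx), sub_zero]

theorem lcsComp_of_mem {k : ℕ} {x : 𝔤} (hx : x ∈ lcsTerm 𝔤 k) :
    lcsComp 𝔤 k x = lcsProj 𝔤 (k + 1) x := by
  rw [lcsComp, LinearMap.sub_apply, lcsProj_eq_zero_iff.mpr hx, sub_zero]

theorem sum_lcsComp [LieRing.IsNilpotent 𝔤] (x : 𝔤) :
    ∑ k ∈ Finset.range (LieModule.nilpotencyLength 𝔤 𝔤), lcsComp 𝔤 k x = x := by
  simp only [lcsComp, LinearMap.sub_apply]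
  rw [Finset.sum_range_sub (fun k => lcsProj 𝔤 k x), lcsProj_eq_self le_rfl,
    lcsProj_eq_zero_iff.mpr (mem_lcsTerm_zero x), sub_zero]

end projection

/-! ### Scaled norms and the upper bound for word lengths -/

section scaledNorm

variable {𝔤 : Type*} [LieRing 𝔤] [LieAlgebra ℝ 𝔤]

theorem Seminorm.exists_lie_le [FiniteDimensional ℝ 𝔤] (N : Seminorm ℝ 𝔤)
    (hN : ∀ v, N v = 0 → v = 0) : ∃ K, 0 ≤ K ∧ ∀ x y : 𝔤, N ⁅x, y⁆ ≤ K * N x * N y := by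
  let b := Module.finBasis ℝ 𝔤
  choose C hC hCN using fun i => N.exists_le_mul hN
    (N.comp (LieModule.toEnd ℝ 𝔤 𝔤 (b i) : 𝔤 →ₗ[ℝ] 𝔤))
  let p : 𝔤 → Seminorm ℝ 𝔤 := fun y => N.comp
    ((LieModule.toEnd ℝ 𝔤 𝔤 : 𝔤 →ₗ[ℝ] Module.End ℝ 𝔤).flip y)
  choose D hD hDN using fun i => N.exists_abs_le_mul hN (b.coord i)
  refine ⟨∑ i, D i * C i, Finset.sum_nonneg fun i _ => mul_nonneg (hD i) (hC i), fun x y => ?_⟩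
  calc N ⁅x, y⁆ = p y (∑ i, b.repr x i • b i) := by rw [b.sum_repr]; rfl
    _ ≤ ∑ i, p y (b.repr x i • b i) := Finset.le_sum_of_subadditive (p y) (map_zero _).le
        (map_add_le_add _) _ _
    _ ≤ ∑ i, D i * C i * N x * N y := Finset.sum_le_sum fun i _ => by
        rw [map_smul_eq_mul]
        calc ‖b.repr x i‖ * p y (b i) ≤ (D i * N x) * (C i * N y) :=
              mul_le_mul (hDN i x) (hCN i y) (apply_nonneg _ _)
                (mul_nonneg (hD i) (apply_nonneg _ _))
          _ = _ := by ring
    _ = _ := by rw [Finset.sum_mul, Finset.sum_mul]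

/-- The norm `∑ₖ r⁻⁽ᵏ⁺¹⁾ N(xₖ)`, where `xₖ` is the component of `x` of degree `k + 1`. -/
noncomputable def scaledNorm (N : Seminorm ℝ 𝔤) {r : ℝ} (hr : 0 ≤ r) : Seminorm ℝ 𝔤 :=
  Seminorm.of (fun x => ∑ k ∈ Finset.range (LieModule.nilpotencyLength 𝔤 𝔤),
      (r ^ (k + 1))⁻¹ * N (lcsComp 𝔤 k x))
    (fun x y => by
      rw [← Finset.sum_add_distrib]
      refine Finset.sum_le_sum fun k _ => ?_
      rw [← mul_add, map_add]
      exact mul_le_mul_of_nonneg_left (map_add_le_add _ _ _) (by positivity))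
    (fun a x => by
      rw [Finset.mul_sum]
      refine Finset.sum_congr rfl fun k _ => ?_
      rw [map_smul, map_smul_eq_mul]
      ring)

theorem scaledNorm_apply (N : Seminorm ℝ 𝔤) {r : ℝ} (hr : 0 ≤ r) (x : 𝔤) :
    scaledNorm N hr x = ∑ k ∈ Finset.range (LieModule.nilpotencyLength 𝔤 𝔤),
      (r ^ (k + 1))⁻¹ * N (lcsComp 𝔤 k x) := rfl

theorem le_scaledNorm [LieRing.IsNilpotent 𝔤] (N : Seminorm ℝ 𝔤) {r : ℝ} (hr : 0 < r) (x : 𝔤)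
    (k : ℕ) : N (lcsComp 𝔤 k x) ≤ r ^ (k + 1) * scaledNorm N hr.le x := by
  obtain hk | hk := lt_or_ge k (LieModule.nilpotencyLength 𝔤 𝔤)
  · rw [← inv_mul_le_iff₀ (by positivity), scaledNorm_apply]
    exact Finset.single_le_sum (f := fun k => (r ^ (k + 1))⁻¹ * N (lcsComp 𝔤 k x))
      (fun j _ => by positivity) (Finset.mem_range.mpr hk)
  · have h : lcsComp 𝔤 k x = 0 := by
      rw [lcsComp, LinearMap.sub_apply, lcsProj_eq_self hk, lcsProj_eq_self (by omega), sub_self]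
    rw [h, map_zero]
    positivity

/-- For `r ≥ 1` every weight is at most `1 / r`, so a fixed finite set of generators has scaled norm
`O(1 / r)`. -/
theorem scaledNorm_le_div (N : Seminorm ℝ 𝔤) {r : ℝ} (hr : 1 ≤ r) (x : 𝔤) :
    scaledNorm N (zero_le_one.trans hr) x ≤
      (∑ k ∈ Finset.range (LieModule.nilpotencyLength 𝔤 𝔤), N (lcsComp 𝔤 k x)) / r := by
  have hr0 : 0 < r := zero_lt_one.trans_le hr
  rw [scaledNorm_apply, Finset.sum_div]
  refine Finset.sum_le_sum fun k _ => ?_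
  rw [div_eq_inv_mul]
  refine mul_le_mul_of_nonneg_right ?_ (apply_nonneg _ _)
  exact inv_anti₀ hr0 (le_self_pow₀ hr (Nat.succ_ne_zero k))

/-- The point is that `M` does not depend on `r`. The bracket of components of degrees `a + 1` and
`b + 1` has only components of degree at least `a + b + 2`, whose weights are at most the product of
the two weights. -/
theorem exists_scaledNorm_lie_le [LieRing.IsNilpotent 𝔤] [FiniteDimensional ℝ 𝔤]
    (N : Seminorm ℝ 𝔤) (hN : ∀ v, N v = 0 → v = 0) :
    ∃ M, 1 ≤ M ∧ ∀ (r : ℝ) (hr : 1 ≤ r) (x y : 𝔤),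
      scaledNorm N (zero_le_one.trans hr) ⁅x, y⁆ ≤ M *
        scaledNorm N (zero_le_one.trans hr) x * scaledNorm N (zero_le_one.trans hr) y := by
  obtain ⟨K, hK, hKN⟩ := N.exists_lie_le hN
  choose C hC hCN using fun k => N.exists_le_mul hN (N.comp (lcsComp 𝔤 k))
  set c := LieModule.nilpotencyLength 𝔤 𝔤 with hc
  set D := ∑ k ∈ Finset.range c, C k with hD
  have hD0 : 0 ≤ D := Finset.sum_nonneg fun k _ => hC k
  refine ⟨max 1 (D * K), le_max_left _ _, fun r hr x y => ?_⟩
  set p := scaledNorm N (zero_le_one.trans hr) with hp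
  have hr0 : 0 < r := zero_lt_one.trans_le hr
  have hterm : ∀ a b, p ⁅lcsComp 𝔤 a x, lcsComp 𝔤 b y⁆ ≤ D * K *
      ((r ^ (a + 1))⁻¹ * N (lcsComp 𝔤 a x)) * ((r ^ (b + 1))⁻¹ * N (lcsComp 𝔤 b y)) := by
    intro a b
    have hmem := lcsTerm_lie a b (lcsComp_mem a x) (lcsComp_mem b y)
    set z := ⁅lcsComp 𝔤 a x, lcsComp 𝔤 b y⁆ with hz
    calc p z = ∑ k ∈ Finset.range c, (r ^ (k + 1))⁻¹ * N (lcsComp 𝔤 k z) := scaledNorm_apply _ _ _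
      _ ≤ ∑ k ∈ Finset.range c, (r ^ (a + b + 2))⁻¹ * (C k * N z) := by
          refine Finset.sum_le_sum fun k _ => ?_
          obtain hk | hk := lt_or_ge k (a + b + 1)
          · rw [lcsComp_eq_zero hk hmem, map_zero, mul_zero]
            have := hC k
            positivity
          · exact mul_le_mul (inv_anti₀ (by positivity) (pow_le_pow_right₀ hr (by omega)))
              (hCN k z) (apply_nonneg _ _) (by positivity)
      _ = (r ^ (a + b + 2))⁻¹ * (D * N z) := by rw [← Finset.mul_sum, hD, Finset.sum_mul]
      _ ≤ (r ^ (a + b + 2))⁻¹ * (D * (K * N (lcsComp 𝔤 a x) * N (lcsComp 𝔤 b y))) := by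
          gcongr
          exact hKN _ _
      _ = _ := by
          rw [show a + b + 2 = (a + 1) + (b + 1) by ring, pow_add, mul_inv]
          ring
  have hx : ⁅x, y⁆ = ∑ a ∈ Finset.range c, ∑ b ∈ Finset.range c,
      ⁅lcsComp 𝔤 a x, lcsComp 𝔤 b y⁆ := by
    conv_lhs => rw [← sum_lcsComp x, ← sum_lcsComp y]
    rw [sum_lie_sum]
  have hsub : ∀ (f : ℕ → 𝔤), p (∑ a ∈ Finset.range c, f a) ≤ ∑ a ∈ Finset.range c, p (f a) :=
    fun f => Finset.le_sum_of_subadditive p (map_zero p).le (map_add_le_add p) _ _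
  calc p ⁅x, y⁆ ≤ ∑ a ∈ Finset.range c, ∑ b ∈ Finset.range c,
        p ⁅lcsComp 𝔤 a x, lcsComp 𝔤 b y⁆ := by
        rw [hx]
        exact (hsub _).trans (Finset.sum_le_sum fun a _ => hsub _)
    _ ≤ ∑ a ∈ Finset.range c, ∑ b ∈ Finset.range c, D * K *
        ((r ^ (a + 1))⁻¹ * N (lcsComp 𝔤 a x)) * ((r ^ (b + 1))⁻¹ * N (lcsComp 𝔤 b y)) :=
        Finset.sum_le_sum fun a _ => Finset.sum_le_sum fun b _ => hterm a b
    _ = D * K * p x * p y := by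
        rw [hp, scaledNorm_apply, scaledNorm_apply, mul_assoc, ← hc, Finset.sum_mul_sum,
          Finset.mul_sum]
        simp only [Finset.mul_sum, mul_assoc]
    _ ≤ max 1 (D * K) * p x * p y := by
        gcongr
        exact le_max_right _ _

theorem Seminorm.lieWord_le (p : Seminorm ℝ 𝔤) {M ε : ℝ} (hM : 1 ≤ M)
    (hp : ∀ x y, p ⁅x, y⁆ ≤ M * p x * p y) {x y : 𝔤} (hx : p x ≤ ε) (hε : ε ≤ 1) (hy : p y ≤ 1)
    (w : List Bool) : p (lieWord w x y) ≤ M ^ w.length * (if true ∈ w then ε else 1) := by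
  have hε0 : 0 ≤ ε := (apply_nonneg p x).trans hx
  have hM0 : 0 ≤ M := zero_le_one.trans hM
  induction w using List.cons_cons_induction with
  | nil => simp [lieWord_nil]
  | single a =>
    cases a
    · simpa [lieWord_singleton] using hy.trans hM
    · simpa [lieWord_singleton] using hx.trans (le_mul_of_one_le_left hε0 hM)
  | cons a b w ih =>
    rw [lieWord_cons_cons]
    have hβ1 : (if true ∈ b :: w then ε else 1) ≤ (1 : ℝ) := by split_ifs <;> linarith
    have hβ0 : (0 : ℝ) ≤ if true ∈ b :: w then ε else 1 := by split_ifs <;> linarith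
    refine (hp _ _).trans ?_
    rw [List.length_cons (a := a), pow_succ', mul_assoc, mul_assoc]
    refine mul_le_mul_of_nonneg_left ?_ hM0
    cases a
    · have h : p y * p (lieWord (b :: w) x y) ≤
          1 * (M ^ (b :: w).length * if true ∈ b :: w then ε else 1) :=
        mul_le_mul hy ih (apply_nonneg _ _) zero_le_one
      simpa using h
    · have h : p x * p (lieWord (b :: w) x y) ≤ ε * (M ^ (b :: w).length * 1) :=
        mul_le_mul hx (ih.trans (mul_le_mul_of_nonneg_left hβ1 (by positivity)))
          (apply_nonneg _ _) hε0
      simpa [mul_comm] using h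

/-- Every term except `y` contains the letter `x` and is therefore `O(ε)`. The constant depends on
`M` but not on `p`, so it serves all scaled norms at once. -/
theorem exists_bch_le (𝔤 : Type*) [LieRing 𝔤] [LieAlgebra ℝ 𝔤] [LieRing.IsNilpotent 𝔤] {M : ℝ}
    (hM : 1 ≤ M) :
    ∃ K, 1 ≤ K ∧ ∀ (p : Seminorm ℝ 𝔤), (∀ x y, p ⁅x, y⁆ ≤ M * p x * p y) →
      ∀ (x y : 𝔤) (ε : ℝ), p x ≤ ε → ε ≤ 1 → p y ≤ 1 → p (bch x y) ≤ p y + K * ε := by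
  obtain ⟨T, c, w, hw, hbch⟩ := exists_bch_expansion 𝔤
  have hM0 : 0 ≤ M := zero_le_one.trans hM
  refine ⟨1 + (1 / 2 * M + ∑ k ∈ T, |c k| * M ^ (w k).length), ?_, fun p hp x y ε hx hε hy => ?_⟩
  · have : 0 ≤ ∑ k ∈ T, |c k| * M ^ (w k).length := Finset.sum_nonneg fun k _ => by positivity
    linarith
  have hε0 : 0 ≤ ε := (apply_nonneg p x).trans hx
  have h1 : p ((1 / 2 : ℝ) • ⁅x, y⁆) ≤ 1 / 2 * M * ε := by
    rw [map_smul_eq_mul, Real.norm_of_nonneg (by norm_num), mul_assoc]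
    refine mul_le_mul_of_nonneg_left ((hp x y).trans ?_) (by norm_num)
    calc M * p x * p y ≤ M * ε * 1 := by gcongr
      _ = M * ε := mul_one _
  have h2 : p (∑ k ∈ T, c k • lieWord (w k) x y) ≤ ∑ k ∈ T, |c k| * M ^ (w k).length * ε := by
    refine (Finset.le_sum_of_subadditive p (map_zero p).le (map_add_le_add p) _ _).trans
      (Finset.sum_le_sum fun k hk => ?_)
    rw [map_smul_eq_mul, mul_assoc, Real.norm_eq_abs]
    have := p.lieWord_le hM hp hx hε hy (w k)
    rw [if_pos ((hw k hk).2 true)] at this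
    exact mul_le_mul_of_nonneg_left this (abs_nonneg _)
  rw [hbch]
  calc p (x + y + (1 / 2 : ℝ) • ⁅x, y⁆ + ∑ k ∈ T, c k • lieWord (w k) x y)
      ≤ p x + p y + p ((1 / 2 : ℝ) • ⁅x, y⁆) + p (∑ k ∈ T, c k • lieWord (w k) x y) :=
        (map_add_le_add _ _ _).trans (add_le_add_left ((map_add_le_add _ _ _).trans
          (add_le_add_left (map_add_le_add _ _ _) _)) _)
    _ ≤ ε + p y + 1 / 2 * M * ε + ∑ k ∈ T, |c k| * M ^ (w k).length * ε := by gcongr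
    _ = _ := by rw [← Finset.sum_mul]; ring

end scaledNorm

/-- At the scale `r = K B' n` a generator has norm at most `1 / (K n)`, so each factor raises the
norm of the logarithm by at most `1 / n`. A word of length `n` stays in the unit ball, and undoing
the scaling gives the bound in each degree. -/
theorem exists_log_wordBall_le {Γ 𝔤 : Type*} [Group Γ] [LieRing 𝔤] [LieAlgebra ℝ 𝔤]
    [LieRing.IsNilpotent 𝔤] [FiniteDimensional ℝ 𝔤] {L : Γ → 𝔤}
    (hL : ∀ a b, L (a * b) = bch (L a) (L b)) (N : Seminorm ℝ 𝔤) (hN : ∀ v, N v = 0 → v = 0)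
    {S : Set Γ} (hS : S.Finite) :
    ∃ C : ℝ, 1 ≤ C ∧ ∀ n : ℕ, 1 ≤ n → ∀ g ∈ wordBall S n, ∀ k,
      N (lcsComp 𝔤 k (L g)) ≤ (C * n) ^ (k + 1) := by
  obtain ⟨M, hM, hMp⟩ := exists_scaledNorm_lie_le N hN
  obtain ⟨K, hK, hKp⟩ := exists_bch_le 𝔤 hM
  obtain ⟨B, hB⟩ : ∃ B : ℝ, ∀ s ∈ S,
      ∑ k ∈ Finset.range (LieModule.nilpotencyLength 𝔤 𝔤), N (lcsComp 𝔤 k (L s)) ≤ B := by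
    obtain ⟨B, hB⟩ := (hS.image fun s =>
      ∑ k ∈ Finset.range (LieModule.nilpotencyLength 𝔤 𝔤), N (lcsComp 𝔤 k (L s))).bddAbove
    exact ⟨B, fun s hs => hB ⟨s, hs, rfl⟩⟩
  -- The maximum with 1 ensures that the scale is at least 1.
  set B' := max B 1 with hB'
  have hB1 : 1 ≤ B' := le_max_right _ _
  refine ⟨K * B', one_le_mul_of_one_le_of_one_le hK hB1, fun n hn g hg k => ?_⟩
  have hn1 : (1 : ℝ) ≤ n := by exact_mod_cast hn
  have hr : 1 ≤ K * B' * n :=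
    one_le_mul_of_one_le_of_one_le (one_le_mul_of_one_le_of_one_le hK hB1) hn1
  have hr0 : 0 < K * B' * n := zero_lt_one.trans_le hr
  set p := scaledNorm N (zero_le_one.trans hr) with hp
  set ε := B' / (K * B' * n) with hε
  have hKε : K * ε * n = 1 := by
    rw [hε]
    field_simp
  have hε0 : 0 ≤ ε := by positivity
  have hε1 : ε ≤ 1 := by
    rw [← hKε]
    calc ε = 1 * ε * 1 := by ring
      _ ≤ K * ε * n := by gcongr
  have hlist : ∀ w : List Γ, w.length ≤ n → (∀ a ∈ w, a ∈ S) →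
      p (L w.prod) ≤ w.length * (K * ε) := by
    intro w
    induction w with
    | nil => simp [log_one hL]
    | cons a w ih =>
      intro hw hS'
      rw [List.length_cons] at hw
      have h1 := ih (by omega) fun b hb => hS' b (List.mem_cons_of_mem a hb)
      have ha : p (L a) ≤ ε := (scaledNorm_le_div N hr _).trans
        (div_le_div_of_nonneg_right ((hB a (hS' a List.mem_cons_self)).trans (le_max_left _ _))
          hr0.le)
      have h2 : p (L w.prod) ≤ 1 := h1.trans (by
        rw [← hKε, mul_comm]
        gcongr
        exact_mod_cast (by omega : w.length ≤ n))
      rw [List.prod_cons, hL, List.length_cons]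
      refine (hKp p (hMp _ hr) _ _ ε ha hε1 h2).trans ?_
      push_cast
      linarith
  obtain ⟨w, hwn, hwS, rfl⟩ := hg
  have h1 : p (L w.prod) ≤ 1 := (hlist w hwn hwS).trans (by
    rw [← hKε, mul_comm]
    gcongr)
  refine (le_scaledNorm N hr0 _ k).trans ?_
  exact mul_le_of_le_one_right (by positivity) h1

/-! ### Word balls -/

section wordBall

variable {Γ : Type*} [Group Γ] {S : Set Γ}

theorem wordBall_finite (hS : S.Finite) (n : ℕ) : (wordBall S n).Finite := by
  induction n with
  | zero =>
    refine (Set.finite_singleton (1 : Γ)).subset ?_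
    rintro _ ⟨w, hw, -, rfl⟩
    rw [List.length_eq_zero_iff.mp (Nat.le_zero.mp hw)]
    rfl
  | succ n ih =>
    refine ((Set.finite_singleton (1 : Γ)).union (hS.image2 (· * ·) ih)).subset ?_
    rintro _ ⟨w, hw, hwS, rfl⟩
    cases w with
    | nil => exact Or.inl rfl
    | cons a w =>
      rw [List.length_cons] at hw
      exact Or.inr ⟨a, hwS a List.mem_cons_self, w.prod,
        ⟨w, by omega, fun b hb => hwS b (List.mem_cons_of_mem a hb), rfl⟩, rfl⟩

theorem one_mem_wordBall (n : ℕ) : (1 : Γ) ∈ wordBall S n :=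
  ⟨[], Nat.zero_le _, by simp, rfl⟩

theorem wordBall_mono {m n : ℕ} (h : m ≤ n) : wordBall S m ⊆ wordBall S n :=
  fun _ ⟨w, hw, hwS, hp⟩ => ⟨w, hw.trans h, hwS, hp⟩

theorem mul_mem_wordBall {m n : ℕ} {a b : Γ} (ha : a ∈ wordBall S m) (hb : b ∈ wordBall S n) :
    a * b ∈ wordBall S (m + n) := by
  obtain ⟨v, hv, hvS, rfl⟩ := ha
  obtain ⟨w, hw, hwS, rfl⟩ := hb
  refine ⟨v ++ w, by rw [List.length_append]; omega, fun a ha => ?_, List.prod_append⟩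
  rcases List.mem_append.mp ha with h | h
  exacts [hvS a h, hwS a h]

theorem inv_mem_wordBall (hS : ∀ a ∈ S, a⁻¹ ∈ S) {n : ℕ} {a : Γ} (ha : a ∈ wordBall S n) :
    a⁻¹ ∈ wordBall S n := by
  obtain ⟨w, hw, hwS, rfl⟩ := ha
  refine ⟨(w.map (·⁻¹)).reverse, by simpa using hw, fun a ha => ?_, (List.prod_inv_reverse w).symm⟩
  obtain ⟨b, hb, rfl⟩ := List.mem_map.mp (List.mem_reverse.mp ha)
  exact hS b (hwS b hb)

theorem pow_mem_wordBall {m : ℕ} {a : Γ} (ha : a ∈ wordBall S m) (n : ℕ) :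
    a ^ n ∈ wordBall S (m * n) := by
  induction n with
  | zero => simpa using one_mem_wordBall 0
  | succ n ih =>
    rw [pow_succ, Nat.mul_succ]
    exact mul_mem_wordBall ih ha

open scoped commutatorElement in
theorem commutator_mem_wordBall (hS : ∀ a ∈ S, a⁻¹ ∈ S) {m n : ℕ} {a b : Γ}
    (ha : a ∈ wordBall S m) (hb : b ∈ wordBall S n) : ⁅a, b⁆ ∈ wordBall S (m + n + m + n) :=
  mul_mem_wordBall (mul_mem_wordBall (mul_mem_wordBall ha hb) (inv_mem_wordBall hS ha))
    (inv_mem_wordBall hS hb)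

theorem exists_mem_wordBall (hS : ∀ a ∈ S, a⁻¹ ∈ S) (hgen : Subgroup.closure S = ⊤) (a : Γ) :
    ∃ m, a ∈ wordBall S m := by
  have ha : a ∈ Subgroup.closure S := hgen ▸ Subgroup.mem_top a
  induction ha using Subgroup.closure_induction with
  | mem a ha => exact ⟨1, [a], le_rfl, by simpa using ha, List.prod_singleton⟩
  | one => exact ⟨0, one_mem_wordBall 0⟩
  | mul a b _ _ ha hb =>
    obtain ⟨m, hm⟩ := ha
    obtain ⟨n, hn⟩ := hb
    exact ⟨m + n, mul_mem_wordBall hm hn⟩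
  | inv a _ ha =>
    obtain ⟨m, hm⟩ := ha
    exact ⟨m, inv_mem_wordBall hS hm⟩

theorem list_ofFn_prod_mem_wordBall {d : ℕ} {g : Fin d → Γ} {m : Fin d → ℕ}
    (h : ∀ i, g i ∈ wordBall S (m i)) : (List.ofFn g).prod ∈ wordBall S (∑ i, m i) := by
  induction d with
  | zero => simpa using one_mem_wordBall _
  | succ d ih =>
    rw [List.ofFn_succ, List.prod_cons, Fin.sum_univ_succ]
    exact mul_mem_wordBall (h 0) (ih fun i => h i.succ)

end wordBall

/-! ### Elements of small word length deep in the lower central series -/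

section reachable

variable {Γ 𝔤 : Type*} [Group Γ] [LieRing 𝔤] [LieAlgebra ℝ 𝔤] {L : Γ → 𝔤} {S : Set Γ}

/-- The multiples `q v` with `q ≤ nᵏ⁺¹` are, modulo the next term of the lower central series,
logarithms of elements of word length `O(n)`. -/
def IsReachable (L : Γ → 𝔤) (S : Set Γ) (k : ℕ) (v : 𝔤) : Prop :=
  ∃ C : ℕ, ∀ n : ℕ, 1 ≤ n → ∀ q : ℕ, q ≤ n ^ (k + 1) →
    ∃ g ∈ wordBall S (C * n), L g ∈ lcsTerm 𝔤 k ∧ L g - (q : ℝ) • v ∈ lcsTerm 𝔤 (k + 1)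

theorem IsReachable.exists_log {k : ℕ} {v : 𝔤} (hv : IsReachable L S k v) :
    ∃ g, L g ∈ lcsTerm 𝔤 k ∧ L g - v ∈ lcsTerm 𝔤 (k + 1) := by
  obtain ⟨C, hC⟩ := hv
  obtain ⟨g, -, hg, hgv⟩ := hC 1 le_rfl 1 (by simp)
  exact ⟨g, hg, by simpa using hgv⟩

theorem IsReachable.mem {k : ℕ} {v : 𝔤} (hv : IsReachable L S k v) : v ∈ lcsTerm 𝔤 k := by
  obtain ⟨g, hg, hgv⟩ := hv.exists_log
  simpa using sub_mem hg (lcsTerm_antitone 𝔤 (Nat.le_succ k) hgv)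

variable [LieRing.IsNilpotent 𝔤]

theorem isReachable_zero (hL : ∀ a b, L (a * b) = bch (L a) (L b)) (hS : ∀ a ∈ S, a⁻¹ ∈ S)
    (hgen : Subgroup.closure S = ⊤) (a : Γ) : IsReachable L S 0 (L a) := by
  obtain ⟨m, hm⟩ := exists_mem_wordBall hS hgen a
  refine ⟨m, fun n _ q hq => ⟨a ^ q, wordBall_mono ?_ (pow_mem_wordBall hm q),
    mem_lcsTerm_zero _, ?_⟩⟩
  · exact Nat.mul_le_mul_left m (by simpa using hq)
  · rw [log_pow hL, sub_self]
    exact zero_mem _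

open scoped commutatorElement in
theorem IsReachable.lie (hL : ∀ a b, L (a * b) = bch (L a) (L b)) (hS : ∀ a ∈ S, a⁻¹ ∈ S)
    (hgen : Subgroup.closure S = ⊤) (a : Γ) {k : ℕ} {v : 𝔤} (hv : IsReachable L S k v) :
    IsReachable L S (k + 1) ⁅L a, v⁆ := by
  obtain ⟨m, hm⟩ := exists_mem_wordBall hS hgen a
  obtain ⟨C, hC⟩ := hv
  -- Two commutators, each of length at most `2 m n + 2 C n`.
  refine ⟨4 * m + 4 * C, fun n hn q hq => ?_⟩
  have hpos : 0 < n ^ (k + 1) := by positivity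
  obtain ⟨g₁, hg₁, hg₁k, hg₁v⟩ := hC n hn (n ^ (k + 1)) le_rfl
  obtain ⟨g₂, hg₂, hg₂k, hg₂v⟩ := hC n hn (q % n ^ (k + 1)) (Nat.mod_lt _ hpos).le
  -- Write `q = q₁ n ^ (k + 1) + q₂` with `q₁ ≤ n`. The commutator of `a ^ q₁` with `g₁` realizes
  -- the first summand, that of `a` with `g₂` the remainder.
  set q₁ := q / n ^ (k + 1) with hq₁
  have hq₁n : q₁ ≤ n := Nat.div_le_of_le_mul (by rwa [← pow_succ])
  have hcomm : ∀ (b g : Γ) (t : ℝ), L g ∈ lcsTerm 𝔤 k → L g - t • v ∈ lcsTerm 𝔤 (k + 1) →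
      L ⁅b, g⁆ - t • ⁅L b, v⁆ ∈ lcsTerm 𝔤 (k + 2) := by
    intro b g t hg hgt
    convert add_mem (log_commutator_sub_mem hL b hg).2
      (lie_mem_lcsTerm_succ_right (L b) hgt) using 1
    rw [lie_sub, lie_smul]
    abel
  have h₁ := (log_commutator_sub_mem hL (a ^ q₁) hg₁k).1
  have h₂ := (log_commutator_sub_mem hL a hg₂k).1
  refine ⟨⁅a ^ q₁, g₁⁆ * ⁅a, g₂⁆, wordBall_mono ?_ (mul_mem_wordBall
    (commutator_mem_wordBall hS (pow_mem_wordBall hm q₁) hg₁)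
    (commutator_mem_wordBall hS hm hg₂)), log_mul_mem hL h₁ h₂, ?_⟩
  · have e1 : m * q₁ ≤ m * n := Nat.mul_le_mul_left m hq₁n
    have e2 : m ≤ m * n := Nat.le_mul_of_pos_right m hn
    rw [add_mul]
    linarith
  · have h := add_mem (add_mem (log_mul_sub_mem_left hL h₁ ⁅a, g₂⁆)
      (hcomm (a ^ q₁) g₁ _ hg₁k hg₁v)) (hcomm a g₂ _ hg₂k hg₂v)
    convert h using 1
    rw [log_pow hL, smul_lie, smul_smul]
    have hq' : (q : ℝ) = ((n ^ (k + 1) : ℕ) : ℝ) * q₁ + ((q % n ^ (k + 1) : ℕ) : ℝ) := by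
      exact_mod_cast (Nat.div_add_mod q (n ^ (k + 1))).symm
    rw [hq', add_smul]
    abel

/-- Modulo the next term, a bracket depends only on its first entry modulo `lcsTerm 𝔤 1` and its
second modulo the next term. So brackets of logarithms with reachable vectors suffice. -/
theorem lcsTerm_le_span_isReachable (hL : ∀ a b, L (a * b) = bch (L a) (L b))
    (hS : ∀ a ∈ S, a⁻¹ ∈ S) (hgen : Subgroup.closure S = ⊤)
    (hspan : ∀ x, x ∈ Submodule.span ℝ (Set.range L) ⊔ lcsTerm 𝔤 1) (k : ℕ) :
    lcsTerm 𝔤 k ≤ Submodule.span ℝ {v | IsReachable L S k v} ⊔ lcsTerm 𝔤 (k + 1) := by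
  induction k with
  | zero =>
    intro x _
    have h : Submodule.span ℝ (Set.range L) ≤ Submodule.span ℝ {v | IsReachable L S 0 v} := by
      refine Submodule.span_mono ?_
      rintro _ ⟨a, rfl⟩
      exact isReachable_zero hL hS hgen a
    exact (sup_le_sup_right h _ : _ ≤ _ ⊔ lcsTerm 𝔤 1) (hspan x)
  | succ k ih =>
    refine lcsTerm_succ_le fun x y hy => ?_
    obtain ⟨x₁, hx₁, x₂, hx₂, rfl⟩ := Submodule.mem_sup.mp (hspan x)
    obtain ⟨y₁, hy₁, y₂, hy₂, hyy⟩ := Submodule.mem_sup.mp (ih hy)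
    have h1 : ⁅x₁, y₁⁆ ∈ Submodule.span ℝ {v | IsReachable L S (k + 1) v} := by
      clear hyy
      induction hx₁ using Submodule.span_induction with
      | mem x hx =>
        obtain ⟨a, rfl⟩ := hx
        induction hy₁ using Submodule.span_induction with
        | mem v hv => exact Submodule.subset_span (hv.lie hL hS hgen a)
        | zero => simp
        | add u v _ _ hu hv =>
          rw [lie_add]
          exact add_mem hu hv
        | smul t u _ hu =>
          rw [lie_smul]
          exact Submodule.smul_mem _ _ hu
      | zero => simp
      | add u v _ _ hu hv =>
        rw [add_lie]
        exact add_mem hu hv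
      | smul t u _ hu =>
        rw [smul_lie]
        exact Submodule.smul_mem _ _ hu
    have h2 : ⁅x₁, y₂⁆ ∈ lcsTerm 𝔤 (k + 1 + 1) := lie_mem_lcsTerm_succ_right _ hy₂
    have h3 : ⁅x₂, y⁆ ∈ lcsTerm 𝔤 (k + 1 + 1) := by
      have := lcsTerm_lie 1 k hx₂ hy
      rwa [show 1 + k + 1 = k + 1 + 1 by omega] at this
    refine Submodule.mem_sup.mpr ⟨⁅x₁, y₁⁆, h1, ⁅x₁, y₂⁆ + ⁅x₂, y⁆, add_mem h2 h3, ?_⟩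
    rw [add_lie, ← add_assoc, ← lie_add, hyy]

end reachable

/-! ### The layers of the lower central series -/

section layer

variable {𝔤 : Type*} [LieRing 𝔤] [LieAlgebra ℝ 𝔤]

/-- This image is a copy of the layer inside `𝔤`; counting takes place there rather than in the
quotient. -/
theorem finrank_map_lcsProj [FiniteDimensional ℝ 𝔤] (k : ℕ) :
    Module.finrank ℝ ((lcsTerm 𝔤 k).map (lcsProj 𝔤 (k + 1))) = Module.finrank ℝ (GrLayer 𝔤 k) := by
  have hker : LinearMap.ker ((lcsProj 𝔤 (k + 1)).domRestrict (lcsTerm 𝔤 k)) =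
      (lcsTerm 𝔤 (k + 1)).comap (lcsTerm 𝔤 k).subtype := by
    ext x
    exact lcsProj_eq_zero_iff
  have hrange : LinearMap.range ((lcsProj 𝔤 (k + 1)).domRestrict (lcsTerm 𝔤 k)) =
      (lcsTerm 𝔤 k).map (lcsProj 𝔤 (k + 1)) := by
    rw [LinearMap.domRestrict, LinearMap.range_comp, Submodule.range_subtype]
  have h1 := LinearMap.finrank_range_add_finrank_ker
    ((lcsProj 𝔤 (k + 1)).domRestrict (lcsTerm 𝔤 k))
  have h2 : Module.finrank ℝ (GrLayer 𝔤 k) + _ = _ := Submodule.finrank_quotient_add_finrank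
    ((lcsTerm 𝔤 (k + 1)).comap (lcsTerm 𝔤 k).subtype)
  rw [hker, hrange] at h1
  omega

theorem exists_layer_basis [FiniteDimensional ℝ 𝔤] {k : ℕ} {E : Set 𝔤} (hE : E ⊆ lcsTerm 𝔤 k)
    (hspan : lcsTerm 𝔤 k ≤ Submodule.span ℝ E ⊔ lcsTerm 𝔤 (k + 1)) :
    ∃ v : Fin (Module.finrank ℝ (GrLayer 𝔤 k)) → 𝔤, (∀ i, v i ∈ E) ∧
      LinearIndependent ℝ (fun i => lcsProj 𝔤 (k + 1) (v i)) ∧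
      ∀ x ∈ lcsTerm 𝔤 k, lcsProj 𝔤 (k + 1) x ∈
        Submodule.span ℝ (Set.range fun i => lcsProj 𝔤 (k + 1) (v i)) := by
  have hmap : Submodule.span ℝ (lcsProj 𝔤 (k + 1) '' E) =
      (lcsTerm 𝔤 k).map (lcsProj 𝔤 (k + 1)) := by
    rw [Submodule.span_image]
    refine le_antisymm (Submodule.map_mono (Submodule.span_le.mpr hE)) ?_
    refine (Submodule.map_mono hspan).trans ?_
    rw [Submodule.map_sup]
    refine sup_le le_rfl ?_
    rintro _ ⟨x, hx, rfl⟩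
    rw [lcsProj_eq_zero_iff.mpr hx]
    exact zero_mem _
  obtain ⟨u, hu, hus, hui⟩ : ∃ u : Fin (Module.finrank ℝ (GrLayer 𝔤 k)) → 𝔤,
      (∀ i, u i ∈ lcsProj 𝔤 (k + 1) '' E) ∧
      Submodule.span ℝ (Set.range u) = Submodule.span ℝ (lcsProj 𝔤 (k + 1) '' E) ∧
      LinearIndependent ℝ u := by
    rw [← finrank_map_lcsProj, ← hmap]
    exact Submodule.exists_fun_fin_finrank_span_eq ℝ _
  choose v hvE hvu using hu
  obtain rfl : (fun i => lcsProj 𝔤 (k + 1) (v i)) = u := funext hvu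
  exact ⟨v, hvE, hui, fun x hx => by rw [hus, hmap]; exact ⟨x, hx, rfl⟩⟩

end layer

/-! ### The lower bound for the number of elements in a layer -/

section layerLower

variable {Γ 𝔤 : Type*} [Group Γ] [LieRing 𝔤] [LieAlgebra ℝ 𝔤] [LieRing.IsNilpotent 𝔤] {L : Γ → 𝔤}

/-- The image in the `(k+1)`-st layer of the elements of a set whose logarithm lies in the
`(k+1)`-st term of the lower central series. -/
def layerImage (L : Γ → 𝔤) (k : ℕ) (B : Set Γ) : Set 𝔤 :=
  {x | ∃ g ∈ B, L g ∈ lcsTerm 𝔤 k ∧ lcsProj 𝔤 (k + 1) (L g) = x}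

/-- Products of reachable elements along a basis of the layer realize all coefficients in a box of
side `n ^ (k + 1)`, and linear independence keeps the resulting points distinct. -/
theorem exists_pow_le_ncard_layerImage [FiniteDimensional ℝ 𝔤]
    (hL : ∀ a b, L (a * b) = bch (L a) (L b)) {S : Set Γ}
    (hfin : S.Finite) (hS : ∀ a ∈ S, a⁻¹ ∈ S) (hgen : Subgroup.closure S = ⊤)
    (hspan : ∀ x, x ∈ Submodule.span ℝ (Set.range L) ⊔ lcsTerm 𝔤 1) (k : ℕ) :
    ∃ C : ℕ, ∀ n : ℕ, 1 ≤ n → n ^ ((k + 1) * Module.finrank ℝ (GrLayer 𝔤 k)) ≤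
      (layerImage L k (wordBall S (C * n))).ncard := by
  obtain ⟨v, hv, hvi, -⟩ := exists_layer_basis (fun _ h => IsReachable.mem h)
    (lcsTerm_le_span_isReachable hL hS hgen hspan k)
  choose C hC using hv
  refine ⟨∑ i, C i, fun n hn => ?_⟩
  choose! g hg hgk hgv using fun i => hC i n hn
  let f : (Fin (Module.finrank ℝ (GrLayer 𝔤 k)) → Fin (n ^ (k + 1))) → 𝔤 :=
    fun q => ∑ i, ((q i : ℕ) : ℝ) • lcsProj 𝔤 (k + 1) (v i)
  have hf : Function.Injective f := by
    intro q q' h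
    have h' := Fintype.linearIndependent_iff.mp hvi (fun i => ((q i : ℕ) : ℝ) - ((q' i : ℕ) : ℝ))
      (by simpa [sub_smul, sub_eq_zero, Finset.sum_sub_distrib] using h)
    funext i
    have := sub_eq_zero.mp (h' i)
    exact Fin.ext (by exact_mod_cast this)
  have hsub : Set.range f ⊆ layerImage L k (wordBall S ((∑ i, C i) * n)) := by
    rintro _ ⟨q, rfl⟩
    have hl : ∀ a ∈ List.ofFn (fun i => g i (q i)), L a ∈ lcsTerm 𝔤 k := by
      intro a ha
      obtain ⟨i, rfl⟩ := (List.mem_ofFn' _ _).mp ha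
      exact hgk i _ (q i).2.le
    obtain ⟨h1, h2⟩ := log_list_prod_sub_mem hL hl
    refine ⟨(List.ofFn fun i => g i (q i)).prod, ?_, h1, ?_⟩
    · rw [Finset.sum_mul]
      exact list_ofFn_prod_mem_wordBall fun i => hg i _ (q i).2.le
    · rw [lcsProj_eq_iff.mpr h2, List.map_ofFn, List.sum_ofFn, map_sum]
      refine Finset.sum_congr rfl fun i _ => ?_
      rw [← map_smul]
      exact lcsProj_eq_iff.mpr (hgv i _ (q i).2.le)
  have hfin' : (layerImage L k (wordBall S ((∑ i, C i) * n))).Finite := by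
    refine ((wordBall_finite hfin ((∑ i, C i) * n)).image
      (fun g => lcsProj 𝔤 (k + 1) (L g))).subset ?_
    rintro _ ⟨g, hg, -, rfl⟩
    exact ⟨g, hg, rfl⟩
  calc n ^ ((k + 1) * Module.finrank ℝ (GrLayer 𝔤 k)) = (Set.range f).ncard := by
        rw [Set.ncard_range_of_injective hf]
        simp [pow_mul]
    _ ≤ _ := Set.ncard_le_ncard hsub hfin'

end layerLower

/-! ### Discreteness of the layers -/

section layerUpper

variable {Γ 𝔤 : Type*} [Group Γ] [LieRing 𝔤] [LieAlgebra ℝ 𝔤] [LieRing.IsNilpotent 𝔤] {L : Γ → 𝔤}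

theorem exists_layer_basis_log [FiniteDimensional ℝ 𝔤] (hL : ∀ a b, L (a * b) = bch (L a) (L b))
    {S : Set Γ} (hS : ∀ a ∈ S, a⁻¹ ∈ S) (hgen : Subgroup.closure S = ⊤)
    (hspan : ∀ x, x ∈ Submodule.span ℝ (Set.range L) ⊔ lcsTerm 𝔤 1) (k : ℕ) :
    ∃ g : Fin (Module.finrank ℝ (GrLayer 𝔤 k)) → Γ, (∀ i, L (g i) ∈ lcsTerm 𝔤 k) ∧
      LinearIndependent ℝ (fun i => lcsProj 𝔤 (k + 1) (L (g i))) ∧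
      ∀ x ∈ lcsTerm 𝔤 k, lcsProj 𝔤 (k + 1) x ∈
        Submodule.span ℝ (Set.range fun i => lcsProj 𝔤 (k + 1) (L (g i))) := by
  have hE : lcsTerm 𝔤 k ≤
      Submodule.span ℝ (Set.range L ∩ lcsTerm 𝔤 k) ⊔ lcsTerm 𝔤 (k + 1) := by
    refine (lcsTerm_le_span_isReachable hL hS hgen hspan k).trans
      (sup_le (Submodule.span_le.mpr fun v hv => ?_) le_sup_right)
    obtain ⟨g, hg, hgv⟩ := IsReachable.exists_log hv
    exact Submodule.mem_sup.mpr ⟨L g, Submodule.subset_span ⟨⟨g, rfl⟩, hg⟩, _, neg_mem hgv,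
      by abel⟩
  obtain ⟨v, hv, hvi, hvs⟩ := exists_layer_basis Set.inter_subset_right hE
  choose g hg using fun i => (hv i).1
  obtain rfl : (fun i => L (g i)) = v := funext hg
  exact ⟨g, fun i => (hv i).2, hvi, hvs⟩

theorem exists_log_eq_sum (hL : ∀ a b, L (a * b) = bch (L a) (L b)) {k d : ℕ} {g : Fin d → Γ}
    (hg : ∀ i, L (g i) ∈ lcsTerm 𝔤 k) (m : Fin d → ℤ) :
    ∃ z, L z ∈ lcsTerm 𝔤 k ∧
      lcsProj 𝔤 (k + 1) (L z) = ∑ i, (m i : ℝ) • lcsProj 𝔤 (k + 1) (L (g i)) := by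
  obtain ⟨h1, h2⟩ := log_list_prod_sub_mem hL (k := k) (l := List.ofFn fun i => g i ^ m i) (by
    intro a ha
    obtain ⟨i, rfl⟩ := (List.mem_ofFn' _ _).mp ha
    rw [log_zpow hL]
    exact Submodule.smul_mem _ _ (hg i))
  refine ⟨_, h1, ?_⟩
  rw [lcsProj_eq_iff.mpr h2, List.map_ofFn, List.sum_ofFn, map_sum]
  refine Finset.sum_congr rfl fun i _ => ?_
  rw [← map_smul, ← log_zpow hL]
  rfl

theorem Seminorm.sum_fract_smul_le {V : Type*} [AddCommGroup V] [Module ℝ V] (N : Seminorm ℝ V)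
    {d : ℕ} (t : Fin d → ℝ) (u : Fin d → V) :
    N (∑ i, Int.fract (t i) • u i) ≤ ∑ i, N (u i) := by
  refine (Finset.le_sum_of_subadditive N (map_zero N).le (map_add_le_add N) _ _).trans
    (Finset.sum_le_sum fun i _ => ?_)
  rw [map_smul_eq_mul, Real.norm_of_nonneg (Int.fract_nonneg _)]
  exact mul_le_of_le_one_left (apply_nonneg _ _) (Int.fract_lt_one _).le

/-- Discreteness survives the passage to quotients because the kernel of each step contains a full
lattice. A point with bounded projection can be multiplied by an element of that lattice so that its
next component falls into a bounded fundamental domain. -/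
theorem finite_lcsProj_log [FiniteDimensional ℝ 𝔤] (hL : ∀ a b, L (a * b) = bch (L a) (L b))
    {S : Set Γ} (hS : ∀ a ∈ S, a⁻¹ ∈ S) (hgen : Subgroup.closure S = ⊤)
    (hspan : ∀ x, x ∈ Submodule.span ℝ (Set.range L) ⊔ lcsTerm 𝔤 1)
    {N : Seminorm ℝ 𝔤} (hN : ∀ v, N v = 0 → v = 0)
    (hdisc : ∀ R : ℝ, {x | x ∈ Set.range L ∧ N x ≤ R}.Finite) (k : ℕ) (R : ℝ) :
    {x | (∃ g, lcsProj 𝔤 k (L g) = x) ∧ N x ≤ R}.Finite := by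
  -- Descending induction on `k`, starting at the nilpotency length, where the projection is the
  -- identity.
  have key : ∀ n k, LieModule.nilpotencyLength 𝔤 𝔤 ≤ k + n →
      ∀ R : ℝ, {x | (∃ g, lcsProj 𝔤 k (L g) = x) ∧ N x ≤ R}.Finite := by
    intro n
    induction n with
    | zero =>
      intro k hk R
      refine (hdisc R).subset ?_
      rintro _ ⟨⟨g, rfl⟩, hR⟩
      rw [lcsProj_eq_self (k := k) hk] at hR ⊢
      exact ⟨⟨g, rfl⟩, hR⟩
    | succ n ih =>
      intro k hk R
      obtain ⟨C, hC, hCN⟩ := N.exists_le_mul hN (N.comp (lcsProj 𝔤 (k + 1)))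
      obtain ⟨g, hg, -, hgs⟩ := exists_layer_basis_log hL hS hgen hspan k
      refine ((ih (k + 1) (by omega)
        (C * R + ∑ i, N (lcsProj 𝔤 (k + 1) (L (g i))))).image (lcsProj 𝔤 k)).subset ?_
      rintro _ ⟨⟨a, rfl⟩, hR⟩
      obtain ⟨t, ht⟩ := (Submodule.mem_span_range_iff_exists_fun ℝ).mp
        (hgs _ (sub_lcsProj_mem k (L a)))
      obtain ⟨z, hz, hzs⟩ := exists_log_eq_sum hL hg fun i => -⌊t i⌋
      have hmul := log_mul_sub_mem_right hL a hz
      have h1 : lcsProj 𝔤 (k + 1) (L (a * z)) = lcsProj 𝔤 (k + 1) (lcsProj 𝔤 k (L a)) +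
          ∑ i, Int.fract (t i) • lcsProj 𝔤 (k + 1) (L (g i)) := by
        rw [lcsProj_eq_iff.mpr hmul, map_add, hzs]
        rw [map_sub, eq_comm, sub_eq_iff_eq_add] at ht
        rw [ht]
        simp only [Int.fract, sub_smul, Finset.sum_sub_distrib, Int.cast_neg, neg_smul,
          Finset.sum_neg_distrib]
        abel
      refine ⟨lcsProj 𝔤 (k + 1) (L (a * z)), ⟨⟨_, rfl⟩, ?_⟩, ?_⟩
      · rw [h1]
        refine (map_add_le_add N _ _).trans (add_le_add ((hCN _).trans ?_)
          (N.sum_fract_smul_le _ _))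
        exact mul_le_mul_of_nonneg_left hR hC
      · rw [lcsProj_lcsProj (Nat.le_succ k), lcsProj_eq_iff]
        convert add_mem (lcsTerm_antitone 𝔤 (Nat.le_succ k) hmul) hz using 1
        abel
  exact key _ k (Nat.le_add_left _ _) R

/-- A point of the layer is a reduced representative, of which there are finitely many, plus an
integer combination of the basis; the coefficients are `O(R)`. -/
theorem exists_ncard_layer_le [FiniteDimensional ℝ 𝔤] (hL : ∀ a b, L (a * b) = bch (L a) (L b))
    {S : Set Γ} (hS : ∀ a ∈ S, a⁻¹ ∈ S) (hgen : Subgroup.closure S = ⊤)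
    (hspan : ∀ x, x ∈ Submodule.span ℝ (Set.range L) ⊔ lcsTerm 𝔤 1)
    {N : Seminorm ℝ 𝔤} (hN : ∀ v, N v = 0 → v = 0)
    (hdisc : ∀ R : ℝ, {x | x ∈ Set.range L ∧ N x ≤ R}.Finite) (k : ℕ) :
    ∃ A : ℕ, ∀ R : ℕ, 1 ≤ R →
      {x | x ∈ layerImage L k Set.univ ∧ N x ≤ R}.Finite ∧
      {x | x ∈ layerImage L k Set.univ ∧ N x ≤ R}.ncard ≤
        A * R ^ Module.finrank ℝ (GrLayer 𝔤 k) := by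
  classical
  obtain ⟨g, hg, hgi, hgs⟩ := exists_layer_basis_log hL hS hgen hspan k
  set u := fun i => lcsProj 𝔤 (k + 1) (L (g i)) with hu
  let b := Module.Basis.span hgi
  choose C hC hCN using fun i => (N.comp (Submodule.span ℝ (Set.range u)).subtype).exists_abs_le_mul
    (fun v hv => Subtype.ext (hN _ hv)) (b.coord i)
  have hCk : ∀ i, C i ≤ ⌈∑ j, C j⌉₊ := fun i =>
    (Finset.single_le_sum (fun j _ => hC j) (Finset.mem_univ i)).trans (Nat.le_ceil _)
  set M := ⌈∑ j, C j⌉₊ with hM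
  have hΦ := finite_lcsProj_log hL hS hgen hspan hN hdisc (k + 1) (∑ i, N (u i))
  set Φ := {x | (∃ g, lcsProj 𝔤 (k + 1) (L g) = x) ∧ N x ≤ ∑ i, N (u i)} with hΦdef
  refine ⟨hΦ.toFinset.card * (2 * M + 3) ^ Module.finrank ℝ (GrLayer 𝔤 k), fun R hR => ?_⟩
  -- Coordinates are at most `M R` in absolute value; the extra 1 absorbs the rounding by the floor.
  let I : Finset (Fin (Module.finrank ℝ (GrLayer 𝔤 k)) → ℤ) :=
    Fintype.piFinset fun _ => Finset.Icc (-((M * R + 1 : ℕ) : ℤ)) ((M * R + 1 : ℕ) : ℤ)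
  let T : Finset 𝔤 := (hΦ.toFinset ×ˢ I).image fun p => p.1 + ∑ i, (p.2 i : ℝ) • u i
  have hsub : {x | x ∈ layerImage L k Set.univ ∧ N x ≤ R} ⊆ T := by
    rintro _ ⟨⟨a, -, ha, rfl⟩, hR'⟩
    set x : Submodule.span ℝ (Set.range u) := ⟨_, hgs _ ha⟩ with hx
    have hsum : ∑ i, b.repr x i • u i = lcsProj 𝔤 (k + 1) (L a) := by
      have h := congrArg Subtype.val (b.sum_repr x)
      rw [AddSubmonoidClass.coe_finsetSum] at h
      simpa [b, Module.Basis.span_apply] using h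
    obtain ⟨z, hz, hzs⟩ := exists_log_eq_sum hL hg fun i => -⌊b.repr x i⌋
    have h1 : lcsProj 𝔤 (k + 1) (L (a * z)) = ∑ i, Int.fract (b.repr x i) • u i := by
      rw [lcsProj_eq_iff.mpr (log_mul_sub_mem_right hL a hz), map_add, hzs, ← hsum]
      simp only [Int.fract, sub_smul, Finset.sum_sub_distrib, Int.cast_neg, neg_smul,
        Finset.sum_neg_distrib, hu]
      abel
    refine Finset.mem_coe.mpr (Finset.mem_image.mpr
      ⟨(lcsProj 𝔤 (k + 1) (L (a * z)), fun i => ⌊b.repr x i⌋), ?_, ?_⟩)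
    · refine Finset.mem_product.mpr ⟨hΦ.mem_toFinset.mpr ⟨⟨_, rfl⟩, ?_⟩,
        Fintype.mem_piFinset.mpr fun i => ?_⟩
      · rw [h1]
        exact N.sum_fract_smul_le _ _
      · have h2 : |b.repr x i| ≤ M * R := (hCN i x).trans
          (mul_le_mul (hCk i) hR' (apply_nonneg _ _) (Nat.cast_nonneg _))
        obtain ⟨h3, h4⟩ := abs_le.mp h2
        rw [Finset.mem_Icc]
        constructor
        · rw [Int.le_floor]
          push_cast
          linarith
        · have h5 : (⌊b.repr x i⌋ : ℝ) ≤ ((M * R + 1 : ℕ) : ℤ) := by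
            push_cast
            linarith [Int.floor_le (b.repr x i)]
          exact_mod_cast h5
    · change lcsProj 𝔤 (k + 1) (L (a * z)) + ∑ i, (⌊b.repr x i⌋ : ℝ) • u i = _
      rw [h1, ← hsum, ← Finset.sum_add_distrib]
      refine Finset.sum_congr rfl fun i _ => ?_
      rw [← add_smul, Int.fract_add_floor]
  refine ⟨T.finite_toSet.subset hsub, (Set.ncard_le_ncard hsub T.finite_toSet).trans ?_⟩
  rw [Set.ncard_coe_finset]
  refine Finset.card_image_le.trans ?_
  rw [Finset.card_product, mul_assoc, ← mul_pow]
  refine Nat.mul_le_mul_left _ ?_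
  simp only [I, Fintype.card_piFinset, Int.card_Icc, Finset.prod_const, Finset.card_univ,
    Fintype.card_fin]
  refine Nat.pow_le_pow_left ?_ _
  have : 2 * (M * R + 1) + 1 ≤ (2 * M + 3) * R := by nlinarith
  omega

theorem exists_ncard_layerImage_le [FiniteDimensional ℝ 𝔤]
    (hL : ∀ a b, L (a * b) = bch (L a) (L b)) {S : Set Γ}
    (hfin : S.Finite) (hS : ∀ a ∈ S, a⁻¹ ∈ S) (hgen : Subgroup.closure S = ⊤)
    (hspan : ∀ x, x ∈ Submodule.span ℝ (Set.range L) ⊔ lcsTerm 𝔤 1)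
    {N : Seminorm ℝ 𝔤} (hN : ∀ v, N v = 0 → v = 0)
    (hdisc : ∀ R : ℝ, {x | x ∈ Set.range L ∧ N x ≤ R}.Finite) (k : ℕ) :
    ∃ A : ℕ, ∀ n : ℕ, 1 ≤ n → (layerImage L k (wordBall S n)).ncard ≤
        A * n ^ ((k + 1) * Module.finrank ℝ (GrLayer 𝔤 k)) := by
  obtain ⟨A, hA⟩ := exists_ncard_layer_le hL hS hgen hspan hN hdisc k
  obtain ⟨C, hC1, hC⟩ := exists_log_wordBall_le hL N hN hfin
  have hM : 1 ≤ ⌈C⌉₊ := Nat.one_le_ceil_iff.mpr (by linarith)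
  refine ⟨A * (⌈C⌉₊ ^ (k + 1)) ^ Module.finrank ℝ (GrLayer 𝔤 k), fun n hn => ?_⟩
  -- The radius is the bound on the degree `k + 1` component of a word of length `n`.
  obtain ⟨h1, h2⟩ := hA ((⌈C⌉₊ * n) ^ (k + 1)) (Nat.one_le_pow _ _ (Nat.mul_pos hM hn))
  refine (Set.ncard_le_ncard ?_ h1).trans (h2.trans (le_of_eq ?_))
  · rintro _ ⟨a, ha, hak, rfl⟩
    refine ⟨⟨a, trivial, hak, rfl⟩, ?_⟩
    rw [← lcsComp_of_mem hak]
    refine (hC n hn a ha k).trans ?_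
    push_cast
    gcongr
    exact Nat.le_ceil C
  · rw [mul_pow, mul_pow, pow_mul, mul_assoc]

end layerUpper

/-! ### The growth of word balls -/

section counting

variable {Γ 𝔤 : Type*} [Group Γ] [LieRing 𝔤] [LieAlgebra ℝ 𝔤] [LieRing.IsNilpotent 𝔤] {L : Γ → 𝔤}
  {S : Set Γ}

/-- Fix a representative `g` in the ball for each coarse class. An element `a` of the class is
determined modulo the next term by `g⁻¹ a`, which has length at most `2 n` and logarithm in `lcsTerm
𝔤 k`. -/
theorem ncard_lcsProj_succ_le (hL : ∀ a b, L (a * b) = bch (L a) (L b)) (hfin : S.Finite)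
    (hS : ∀ a ∈ S, a⁻¹ ∈ S) (k n : ℕ) :
    ((fun g => lcsProj 𝔤 (k + 1) (L g)) '' wordBall S n).ncard ≤
      ((fun g => lcsProj 𝔤 k (L g)) '' wordBall S n).ncard *
        (layerImage L k (wordBall S (n + n))).ncard := by
  have hA := (wordBall_finite hfin n).image fun g => lcsProj 𝔤 k (L g)
  have hB : (layerImage L k (wordBall S (n + n))).Finite := by
    refine ((wordBall_finite hfin (n + n)).image fun g => lcsProj 𝔤 (k + 1) (L g)).subset ?_
    rintro _ ⟨g, hg, -, rfl⟩
    exact ⟨g, hg, rfl⟩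
  choose! rep hrep hrep' using fun (v : 𝔤)
    (hv : v ∈ (fun g => lcsProj 𝔤 k (L g)) '' wordBall S n) => hv
  rw [← Set.ncard_prod]
  refine (Set.ncard_le_ncard ?_ ((hA.prod hB).image
    fun p => lcsProj 𝔤 (k + 1) (L (rep p.1)) + p.2)).trans (Set.ncard_image_le (hA.prod hB))
  rintro _ ⟨a, ha, rfl⟩
  have hv : lcsProj 𝔤 k (L a) ∈ (fun g => lcsProj 𝔤 k (L g)) '' wordBall S n := ⟨a, ha, rfl⟩
  set g := rep (lcsProj 𝔤 k (L a)) with hg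
  have hmem : L (g⁻¹ * a) ∈ lcsTerm 𝔤 k :=
    (log_inv_mul_mem_iff hL).mpr (lcsProj_eq_iff.mp (hrep' _ hv).symm)
  refine ⟨(lcsProj 𝔤 k (L a), lcsProj 𝔤 (k + 1) (L (g⁻¹ * a))), ⟨hv, g⁻¹ * a,
    mul_mem_wordBall (inv_mem_wordBall hS (hrep _ hv)) ha, hmem, rfl⟩, ?_⟩
  have h := lcsProj_eq_iff.mpr (log_mul_sub_mem_right hL g hmem)
  rw [mul_inv_cancel_left, map_add] at h
  exact h.symm

/-- The products of a representative with an element of the layer are distinct: the coarse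
projection recovers the representative, and subtraction recovers the layer component. -/
theorem mul_ncard_le_ncard_lcsProj_succ (hL : ∀ a b, L (a * b) = bch (L a) (L b))
    (hfin : S.Finite) (k m n : ℕ) :
    ((fun g => lcsProj 𝔤 k (L g)) '' wordBall S m).ncard *
        (layerImage L k (wordBall S n)).ncard ≤
      ((fun g => lcsProj 𝔤 (k + 1) (L g)) '' wordBall S (m + n)).ncard := by
  choose! rep hrep hrep' using fun (v : 𝔤)
    (hv : v ∈ (fun g => lcsProj 𝔤 k (L g)) '' wordBall S m) => hv
  rw [← Set.ncard_prod]
  refine Set.ncard_le_ncard_of_injOn (fun p => lcsProj 𝔤 (k + 1) (L (rep p.1)) + p.2) ?_ ?_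
    ((wordBall_finite hfin (m + n)).image _)
  · rintro ⟨v, _⟩ ⟨hv, h, hh, hhk, rfl⟩
    refine ⟨rep v * h, mul_mem_wordBall (hrep v hv) hh, ?_⟩
    change lcsProj 𝔤 (k + 1) (L (rep v * h)) = _
    rw [lcsProj_eq_iff.mpr (log_mul_sub_mem_right hL (rep v) hhk), map_add]
  · have key : ∀ p ∈ ((fun g => lcsProj 𝔤 k (L g)) '' wordBall S m) ×ˢ
        layerImage L k (wordBall S n),
        lcsProj 𝔤 k (lcsProj 𝔤 (k + 1) (L (rep p.1)) + p.2) = p.1 := by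
      rintro ⟨v, _⟩ ⟨hv, h, hh, hhk, rfl⟩
      rw [map_add, lcsProj_lcsProj (Nat.le_succ k), lcsProj_lcsProj (Nat.le_succ k),
        lcsProj_eq_zero_iff.mpr hhk, add_zero]
      exact hrep' v hv
    intro p hp q hq h
    have h1 : p.1 = q.1 := by rw [← key p hp, ← key q hq]; exact congrArg _ h
    refine Prod.ext h1 ?_
    simp only [h1] at h
    exact add_left_cancel h

variable [FiniteDimensional ℝ 𝔤]

theorem exists_ncard_wordBall_le (hL : ∀ a b, L (a * b) = bch (L a) (L b))
    (hinj : Function.Injective L) (hfin : S.Finite) (hS : ∀ a ∈ S, a⁻¹ ∈ S)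
    (hgen : Subgroup.closure S = ⊤)
    (hspan : ∀ x, x ∈ Submodule.span ℝ (Set.range L) ⊔ lcsTerm 𝔤 1)
    {N : Seminorm ℝ 𝔤} (hN : ∀ v, N v = 0 → v = 0)
    (hdisc : ∀ R : ℝ, {x | x ∈ Set.range L ∧ N x ≤ R}.Finite)
    {m : ℕ} (hm : LieModule.nilpotencyLength 𝔤 𝔤 ≤ m) :
    ∃ A : ℕ, ∀ n : ℕ, 1 ≤ n → (wordBall S n).ncard ≤
      A * n ^ (∑ k ∈ Finset.range m, (k + 1) * Module.finrank ℝ (GrLayer 𝔤 k)) := by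
  have key : ∀ k, ∃ A : ℕ, ∀ n : ℕ, 1 ≤ n →
      ((fun g => lcsProj 𝔤 k (L g)) '' wordBall S n).ncard ≤
        A * n ^ (∑ k ∈ Finset.range k, (k + 1) * Module.finrank ℝ (GrLayer 𝔤 k)) := by
    intro k
    induction k with
    | zero =>
      refine ⟨1, fun n _ => ?_⟩
      have h : (fun g => lcsProj 𝔤 0 (L g)) '' wordBall S n ⊆ {0} := by
        rintro _ ⟨g, -, rfl⟩
        exact lcsProj_eq_zero_iff.mpr (mem_lcsTerm_zero _)
      simpa using Set.ncard_le_ncard h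
    | succ k ih =>
      obtain ⟨A, hA⟩ := ih
      obtain ⟨B, hB⟩ := exists_ncard_layerImage_le hL hfin hS hgen hspan hN hdisc k
      refine ⟨A * B * 2 ^ ((k + 1) * Module.finrank ℝ (GrLayer 𝔤 k)), fun n hn => ?_⟩
      refine (ncard_lcsProj_succ_le hL hfin hS k n).trans
        ((Nat.mul_le_mul (hA n hn) (hB (n + n) (by omega))).trans (le_of_eq ?_))
      rw [Finset.sum_range_succ, pow_add, ← two_mul, mul_pow]
      ring
  obtain ⟨A, hA⟩ := key m
  refine ⟨A, fun n hn => (le_of_eq ?_).trans (hA n hn)⟩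
  simp only [lcsProj_eq_self hm]
  exact (Set.ncard_image_of_injective _ hinj).symm

theorem exists_pow_le_ncard_wordBall (hL : ∀ a b, L (a * b) = bch (L a) (L b))
    (hfin : S.Finite) (hS : ∀ a ∈ S, a⁻¹ ∈ S) (hgen : Subgroup.closure S = ⊤)
    (hspan : ∀ x, x ∈ Submodule.span ℝ (Set.range L) ⊔ lcsTerm 𝔤 1) (m : ℕ) :
    ∃ C : ℕ, ∀ n : ℕ, 1 ≤ n →
      n ^ (∑ k ∈ Finset.range m, (k + 1) * Module.finrank ℝ (GrLayer 𝔤 k)) ≤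
        (wordBall S (C * n)).ncard := by
  have key : ∀ k, ∃ C : ℕ, ∀ n : ℕ, 1 ≤ n →
      n ^ (∑ k ∈ Finset.range k, (k + 1) * Module.finrank ℝ (GrLayer 𝔤 k)) ≤
        ((fun g => lcsProj 𝔤 k (L g)) '' wordBall S (C * n)).ncard := by
    intro k
    induction k with
    | zero =>
      refine ⟨0, fun n _ => ?_⟩
      rw [Finset.sum_range_zero, pow_zero, Nat.one_le_iff_ne_zero]
      exact ((Set.ncard_pos ((wordBall_finite hfin _).image _)).mpr
        ⟨_, 1, one_mem_wordBall _, rfl⟩).ne'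
    | succ k ih =>
      obtain ⟨C, hC⟩ := ih
      obtain ⟨C', hC'⟩ := exists_pow_le_ncard_layerImage hL hfin hS hgen hspan k
      refine ⟨C + C', fun n hn => ?_⟩
      rw [Finset.sum_range_succ, pow_add, add_mul C C' n]
      exact (Nat.mul_le_mul (hC n hn) (hC' n hn)).trans
        (mul_ncard_le_ncard_lcsProj_succ hL hfin k _ _)
  obtain ⟨C, hC⟩ := key m
  exact ⟨C, fun n hn => (hC n hn).trans (Set.ncard_image_le (wordBall_finite hfin _))⟩

end counting

/-! ### The homogeneous dimension -/

theorem GrowthLE.trans {f g h : ℕ → ℕ} (hfg : GrowthLE f g) (hgh : GrowthLE g h) :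
    GrowthLE f h := by
  obtain ⟨C, hC, hC'⟩ := hfg
  obtain ⟨D, hD, hD'⟩ := hgh
  refine ⟨C * D, Nat.mul_pos hC hD, fun n hn => (hC' n hn).trans ?_⟩
  rw [mul_assoc, mul_comm C D, mul_assoc]
  exact Nat.mul_le_mul_left C (hD' (C * n) (Nat.mul_pos hC hn))

theorem le_of_growthLE_pow {d e : ℕ} (h : GrowthLE (fun n => n ^ d) fun n => n ^ e) : d ≤ e := by
  obtain ⟨C, hC, hC'⟩ := h
  by_contra! hde
  -- At `n = C ^ (e + 1) + 1` the comparison would give `n ≤ C ^ (e + 1)`.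
  have hn : 1 ≤ C ^ (e + 1) + 1 := by omega
  have h1 : (C ^ (e + 1) + 1) ^ d ≤ C * (C * (C ^ (e + 1) + 1)) ^ e := hC' _ hn
  have h2 := (Nat.pow_le_pow_right hn (show e + 1 ≤ d from hde)).trans h1
  rw [mul_pow, ← mul_assoc, ← pow_succ', pow_succ'] at h2
  have h3 := Nat.le_of_mul_le_mul_right h2 (by positivity)
  omega

/-- A function `L` that behaves like the logarithm of a lattice determines the homogeneous
dimension. -/
theorem homogeneousDimension_eq_sum {Γ 𝔤 : Type*} [Group Γ] [Group.FG Γ] [LieRing 𝔤]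
    [LieAlgebra ℝ 𝔤] [LieRing.IsNilpotent 𝔤] [FiniteDimensional ℝ 𝔤] {L : Γ → 𝔤}
    (hL : ∀ a b, L (a * b) = bch (L a) (L b)) (hinj : Function.Injective L)
    (hspan : ∀ x, x ∈ Submodule.span ℝ (Set.range L) ⊔ lcsTerm 𝔤 1)
    {N : Seminorm ℝ 𝔤} (hN : ∀ v, N v = 0 → v = 0)
    (hdisc : ∀ R : ℝ, {x | x ∈ Set.range L ∧ N x ≤ R}.Finite)
    {m : ℕ} (hm : LieModule.nilpotencyLength 𝔤 𝔤 ≤ m) :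
    homogeneousDimension Γ =
      ∑ k ∈ Finset.range m, (k + 1) * Module.finrank ℝ (GrLayer 𝔤 k) := by
  set D := ∑ k ∈ Finset.range m, (k + 1) * Module.finrank ℝ (GrLayer 𝔤 k) with hD
  have hgrowth : ∀ S : Set Γ, S.Finite → (∀ a ∈ S, a⁻¹ ∈ S) → Subgroup.closure S = ⊤ →
      GrowthLE (fun n => (wordBall S n).ncard) (fun n => n ^ D) ∧
        GrowthLE (fun n => n ^ D) (fun n => (wordBall S n).ncard) := by
    intro S hfin hS hgen
    obtain ⟨A, hA⟩ := exists_ncard_wordBall_le hL hinj hfin hS hgen hspan hN hdisc hm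
    obtain ⟨C, hC⟩ := exists_pow_le_ncard_wordBall hL hfin hS hgen hspan m
    refine ⟨⟨A + 1, Nat.succ_pos A, fun n hn => (hA n hn).trans (Nat.mul_le_mul (Nat.le_succ A)
      (Nat.pow_le_pow_left (Nat.le_mul_of_pos_left n (Nat.succ_pos A)) _))⟩,
      ⟨C + 1, Nat.succ_pos C, fun n hn => (hC n hn).trans ?_⟩⟩
    refine (Set.ncard_le_ncard (wordBall_mono (Nat.mul_le_mul_right n (Nat.le_succ C)))
      (wordBall_finite hfin _)).trans (Nat.le_mul_of_pos_left _ (Nat.succ_pos C))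
  -- The set of admissible degrees is exactly `{D}`, so the infimum is not a default value.
  have hset : {d | ∃ S : Set Γ, S.Finite ∧ (∀ a ∈ S, a⁻¹ ∈ S) ∧ Subgroup.closure S = ⊤ ∧
      GrowthLE (fun n => (wordBall S n).ncard) (fun n => n ^ d) ∧
      GrowthLE (fun n => n ^ d) (fun n => (wordBall S n).ncard)} = {D} := by
    refine Set.eq_singleton_iff_unique_mem.mpr ⟨?_, ?_⟩
    · obtain ⟨T, hT, hTfin⟩ := (Group.fg_iff (G := Γ)).mp inferInstance
      have hgen : Subgroup.closure (T ∪ T⁻¹) = ⊤ :=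
        top_le_iff.mp (hT.ge.trans (Subgroup.closure_mono Set.subset_union_left))
      have hfin : (T ∪ T⁻¹).Finite := hTfin.union hTfin.inv
      have hsymm : ∀ a ∈ T ∪ T⁻¹, a⁻¹ ∈ T ∪ T⁻¹ := by
        rintro a (ha | ha)
        · exact Or.inr (by simpa using ha)
        · exact Or.inl ha
      exact ⟨_, hfin, hsymm, hgen, hgrowth _ hfin hsymm hgen⟩
    · rintro d ⟨S, hfin, hS, hgen, h1, h2⟩
      obtain ⟨h3, h4⟩ := hgrowth S hfin hS hgen
      exact le_antisymm (le_of_growthLE_pow (h2.trans h3)) (le_of_growthLE_pow (h4.trans h1))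
  rw [homogeneousDimension, hset, csInf_singleton]

/-! ### Lattices in exponential groups -/

section lattice

variable {Γ 𝔤 : Type*} [Group Γ] [LieRing 𝔤] [LieAlgebra ℝ 𝔤] {i : Γ → ExpGroup 𝔤}

theorem exists_definite_seminorm_isCompact (V : Type*) [AddCommGroup V] [Module ℝ V]
    [FiniteDimensional ℝ V] [TopologicalSpace V] [IsModuleTopology ℝ V] :
    ∃ N : Seminorm ℝ V, (∀ v, N v = 0 → v = 0) ∧ ∀ R : ℝ, IsCompact {v | N v ≤ R} := by
  have : ContinuousAdd V := IsModuleTopology.toContinuousAdd ℝ V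
  let e := (Module.finBasis ℝ V).equivFun
  refine ⟨(normSeminorm ℝ (Fin (Module.finrank ℝ V) → ℝ)).comp e.toLinearMap, fun v hv =>
    e.map_eq_zero_iff.mp (norm_eq_zero.mp hv), fun R => ?_⟩
  have h := (isCompact_closedBall (0 : Fin (Module.finrank ℝ V) → ℝ) R).image
    (IsModuleTopology.continuous_of_linearMap (R := ℝ) e.symm.toLinearMap)
  convert h using 1
  ext v
  constructor
  · intro hv
    exact ⟨e v, mem_closedBall_zero_iff.mpr hv, e.symm_apply_apply v⟩
  · rintro ⟨w, hw, rfl⟩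
    change ‖e (e.symm w)‖ ≤ R
    rw [e.apply_symm_apply]
    exact mem_closedBall_zero_iff.mp hw

theorem IsMaltsevCompletion.log_mul (hi : IsMaltsevCompletion i) (a b : Γ) :
    (i (a * b)).log = bch (i a).log (i b).log := by
  rw [hi.map_mul]
  rfl

/-- Otherwise a nonzero linear form vanishes on the logarithms of `Γ` and on commutators. Being
additive for the group law, it takes only values attained on the compact set `K`, whereas a nonzero
linear form is unbounded. -/
theorem IsMaltsevCompletion.mem_span_sup (hi : IsMaltsevCompletion i) (x : 𝔤) :
    x ∈ Submodule.span ℝ (Set.range fun a => (i a).log) ⊔ lcsTerm 𝔤 1 := by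
  have := hi.nilpotent
  by_contra hx
  obtain ⟨ψ, hψ, hker⟩ := Submodule.exists_le_ker_of_lt_top
    (Submodule.span ℝ (Set.range fun a => (i a).log) ⊔ lcsTerm 𝔤 1)
    (lt_top_iff_ne_top.mpr fun h => hx (h ▸ Submodule.mem_top))
  obtain ⟨K, hK, hcov⟩ := hi.cocompact
  obtain ⟨M, hM⟩ := (hK.image (ExpGroup.continuous_linearForm ψ)).bddAbove
  have hle : ∀ y, ψ y ≤ M := by
    intro y
    obtain ⟨a, k, hk, hy⟩ := hcov (ExpGroup.exp y)
    have hy' : y = bch (i a).log k.log := congrArg ExpGroup.log hy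
    have h1 : ψ (y - ((i a).log + k.log)) = 0 :=
      hker (Submodule.mem_sup_right (hy' ▸ bch_sub_add_mem_one _ _))
    have h2 : ψ (i a).log = 0 :=
      hker (Submodule.mem_sup_left (Submodule.subset_span ⟨a, rfl⟩))
    rw [map_sub, map_add, h2, zero_add, sub_eq_zero] at h1
    rw [h1]
    exact hM ⟨k, hk, rfl⟩
  obtain ⟨v, hv⟩ := DFunLike.ne_iff.mp hψ
  have h := hle (((M + 1) / ψ v) • v)
  rw [map_smul, smul_eq_mul, div_mul_cancel₀ _ hv] at h
  linarith

theorem IsMaltsevCompletion.exists_isOpen_iff (hi : IsMaltsevCompletion i) :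
    ∃ W : Set 𝔤, @IsOpen 𝔤 (moduleTopology ℝ 𝔤) W ∧ ∀ a, (i a).log ∈ W ↔ a = 1 := by
  let _ : TopologicalSpace 𝔤 := moduleTopology ℝ 𝔤
  have := hi.discrete
  obtain ⟨V, hV, hVi⟩ := isOpen_induced_iff.mp
    (isOpen_discrete ({⟨i 1, 1, rfl⟩} : Set (Set.range i)))
  obtain ⟨W, hW, rfl⟩ := isOpen_induced_iff.mp hV
  refine ⟨W, hW, fun a => ?_⟩
  have h := Set.ext_iff.mp hVi ⟨i a, a, rfl⟩
  simp only [Set.mem_preimage, Set.mem_singleton_iff] at h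
  exact h.trans (Subtype.ext_iff.trans hi.injective.eq_iff)

theorem Continuous.exists_nhds_forall_mem {X Y : Type*} [TopologicalSpace X] [TopologicalSpace Y]
    {m : X → X → Y} (hm : Continuous fun q : X × X => m q.1 q.2) {W : Set Y} (hW : IsOpen W) {p : X}
    (hp : m p p ∈ W) : ∃ O ∈ nhds p, ∀ x ∈ O, ∀ y ∈ O, m x y ∈ W := by
  have h : (fun q : X × X => m q.1 q.2) ⁻¹' W ∈ nhds (p, p) :=
    hm.continuousAt.preimage_mem_nhds (hW.mem_nhds hp)
  rw [nhds_prod_eq, Filter.mem_prod_same_iff] at h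
  obtain ⟨O, hO, hOW⟩ := h
  exact ⟨O, hO, fun x hx y hy => hOW (Set.mk_mem_prod hx hy)⟩

theorem continuous_bch_neg_left (𝔤 : Type*) [LieRing 𝔤] [LieAlgebra ℝ 𝔤] [LieRing.IsNilpotent 𝔤]
    [FiniteDimensional ℝ 𝔤] [TopologicalSpace 𝔤] [IsModuleTopology ℝ 𝔤] :
    Continuous fun p : 𝔤 × 𝔤 => bch (-p.1) p.2 := by
  have : ContinuousNeg 𝔤 := IsModuleTopology.continuousNeg ℝ 𝔤
  have hneg : Continuous fun q : 𝔤 × 𝔤 => (-q.1, q.2) := by fun_prop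
  have h := Continuous.comp (continuous_bch 𝔤) hneg
  exact h

/-- A set that is discrete for the group structure meets compact sets in finite sets. -/
theorem finite_range_inter_of_isCompact [LieRing.IsNilpotent 𝔤] [FiniteDimensional ℝ 𝔤]
    [TopologicalSpace 𝔤] [IsModuleTopology ℝ 𝔤] {L : Γ → 𝔤}
    (hL : ∀ a b, L (a * b) = bch (L a) (L b)) {W : Set 𝔤} (hW : IsOpen W)
    (hWi : ∀ a, L a ∈ W ↔ a = 1) {K : Set 𝔤} (hK : IsCompact K) : (Set.range L ∩ K).Finite := by
  have : T2Space 𝔤 := t2Space_of_isModuleTopology 𝔤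
  by_contra hinf
  obtain ⟨p, -, hp⟩ := Set.Infinite.exists_accPt_of_subset_isCompact hinf hK
    Set.inter_subset_right
  have h0 : bch (-p) p ∈ W := by
    rw [bch_neg_self, ← log_one hL]
    exact (hWi 1).mpr rfl
  -- Two distinct lattice points close to an accumulation point `p` have a quotient close to the
  -- identity, hence equal to it. This excludes accumulation outside the lattice too.
  obtain ⟨O, hO, hOW⟩ := Continuous.exists_nhds_forall_mem (m := fun x y => bch (-x) y)
    (continuous_bch_neg_left 𝔤) hW h0
  obtain ⟨_, ⟨hxO, ⟨a, rfl⟩, -⟩, hxp⟩ := accPt_iff_nhds.mp hp O hO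
  obtain ⟨_, ⟨hyO, ⟨b, rfl⟩, -⟩, -⟩ := accPt_iff_nhds.mp hp (O ∩ {L a}ᶜ)
    (Filter.inter_mem hO (isOpen_compl_singleton.mem_nhds hxp.symm))
  have h := hOW _ hxO _ hyO.1
  rw [← log_inv hL, ← hL, hWi, inv_mul_eq_one] at h
  exact Set.mem_compl_singleton_iff.mp hyO.2 (congrArg L h.symm)

/-- The Bass–Guivarc'h formula for lattices in simply connected nilpotent Lie groups. -/
theorem IsMaltsevCompletion.homogeneousDimension_eq [Group.FG Γ] (hi : IsMaltsevCompletion i)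
    {m : ℕ} (hm : LieModule.nilpotencyLength 𝔤 𝔤 ≤ m) :
    homogeneousDimension Γ =
      ∑ k ∈ Finset.range m, (k + 1) * Module.finrank ℝ (GrLayer 𝔤 k) := by
  have := hi.nilpotent
  have := hi.finiteDimensional
  let _ : TopologicalSpace 𝔤 := moduleTopology ℝ 𝔤
  have : IsModuleTopology ℝ 𝔤 := ⟨rfl⟩
  obtain ⟨N, hN, hcomp⟩ := exists_definite_seminorm_isCompact 𝔤
  obtain ⟨W, hW, hWi⟩ := hi.exists_isOpen_iff
  exact homogeneousDimension_eq_sum (L := fun a => (i a).log) hi.log_mul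
    (fun a b h => hi.injective (ExpGroup.ext h)) hi.mem_span_sup hN
    (fun R => finite_range_inter_of_isCompact hi.log_mul hW hWi (hcomp R)) hm

end lattice

/-! ### The dichotomy for lattices -/

theorem mainTheorem2 {Γ Δ 𝔤 𝔥 : Type*}
    [Group Γ] [Group.FG Γ] [Group.IsNilpotent Γ] (hΓ : ∀ a : Γ, IsOfFinOrder a → a = 1)
    [Group Δ] [Group.FG Δ] [Group.IsNilpotent Δ] (hΔ : ∀ a : Δ, IsOfFinOrder a → a = 1)
    [LieRing 𝔤] [LieAlgebra ℝ 𝔤] [LieRing 𝔥] [LieAlgebra ℝ 𝔥]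
    (i : Γ → ExpGroup 𝔤) (hi : IsMaltsevCompletion i)
    (j : Δ → ExpGroup 𝔥) (hj : IsMaltsevCompletion j)
    (hd : homogeneousDimension Γ = homogeneousDimension Δ)
    (N : Seminorm ℝ (GrLayer 𝔥 0)) (hN : ∀ v, N v = 0 → v = 0)
    (F : CarnotCompletion 𝔤 →ₙ* CarnotCompletion 𝔥) (hF : Continuous F) :
    (∃ e : CarnotCompletion 𝔤 ≃ₜ* CarnotCompletion 𝔥, ∀ x, e x = F x) ∨
    ∃ l : CarnotCompletion 𝔥 → ℝ, Continuous l ∧ (∀ x y, l (x * y) = l x + l y) ∧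
      (∀ x, l (F x) = 0) ∧ IsLUB (l '' {h | ccDist N 1 h < 1}) 1 := by
  have := hi.nilpotent
  have := hi.finiteDimensional
  have := hj.nilpotent
  have := hj.finiteDimensional
  -- With the larger of the two lengths, both dimension formulas run over the same range.
  refine CarnotCompletion.equiv_or_exists_form (le_max_left (LieModule.nilpotencyLength 𝔤 𝔤)
    (LieModule.nilpotencyLength 𝔥 𝔥)) ?_ N hN F hF
  rw [← hi.homogeneousDimension_eq (le_max_left _ _), ← hj.homogeneousDimension_eq
    (le_max_right _ _), hd]
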